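/- Let the parameter space of ${}_3F_2(a,b,c;d,e;1)$ be $\mathbb{C}^3\times\mathbb{C}^2$, with coordinates $(a,b,c;d,e)$, and put $(a,b,c;d,e)=(x,y,z;u,v)A$, where $$A=\begin{pmatrix}1&0&0&1&1\\0&1&0&1&1\\0&0&1&1&1\\1&1&1&2&1\\1&1&1&1&2\end{pmatrix}.$$ The Thomae group $\mathfrak{T}\cong S_5$ is the group of linear automorphisms of $\mathbb{C}^3\times\mathbb{C}^2$ that permute the coordinates $x,y,z,u,v$. The Dixon--Watson--Whipple orbit is the $\mathfrak{T}$-orbit of the Dixon $3$-plane $\{d=1+a-b,\ e=1+a-c\}$ (it contains the Watson $3$-plane $\{d=\frac12+\frac12a+\frac12b,\ e=2c\}$ and the Whipple $3$-plane $\{b=1-a,\ e=1+2c-d\}$). The Whipple ${}_2F_1(-1)$ orbit is the $\mathfrak{T}$-orbit of $\mathcal{W}_0=\{(\alpha,\alpha+\frac12,\beta;\gamma,\gamma+\frac12)\}$. Let $P:\mathcal{W}_0\to\mathbb{C}^2\times\mathbb{C}$, $P(\alpha,\alpha+\frac12,\beta;\gamma,\gamma+\frac12)=(2\alpha,\beta;2\gamma-\beta)$,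 the target being the space of parameters $(a,b;c)$ of ${}_2F_1(a,b;c;-1)$. A $3$-plane $\mathcal{W}=T\mathcal{W}_0$, $T\in\mathfrak{T}$, is projected to $\mathbb{C}^2\times\mathbb{C}$ by $PT^{-1}$ (for any such $T$). Call two subsets of $\mathbb{C}^2\times\mathbb{C}$ equivalent if one is the image of the other under an element of the group generated by $(a,b;c)\mapsto(b,a;c)$ and Euler's transformation $(a,b;c)\mapsto(c-a,c-b;c)$. Consider the sets $PT^{-1}(\mathcal{D}\cap T\mathcal{W}_0)$, where $\mathcal{D}$ lies on the Dixon--Watson--Whipple orbit, $T\in\mathfrak{T}$, and $\mathcal{D}\cap T\mathcal{W}_0\neq\emptyset$. Up to equivalence they comprise the Kummer $2$-plane $\mathcal{K}=\{(a,b;1+a-b)\}$ and exactly four lines, namely those traced out, as $a$ ranges over $\mathbb{C}$, by the parameters $(a+\nu,b;a-b)$ of the four series below, where $\nu=-4,-\frac32,-\frac12,2$ respectively. That is: each of these sets is equivalent to a subset of $\mathcal{K}$ or to one of the four lines; $\mathcal{K}$ and each of the four lines are equivalent to such a set; none of the four lines is equivalent to a subset of $\mathcal{K}$; and no two of the four lines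 are equivalent. Moreover, writing $\Gamma\left[{p_1,\dots,p_m\atop q_1,\dots,q_n}\right]=\prod_i\Gamma(p_i)/\prod_j\Gamma(q_j)$ (with $1/\Gamma=0$ at the poles of $\Gamma$), for $a\in\mathbb{C}$: 1. ${}_2F_1\left(a-4,\frac23a-1;1+\frac13a;-1\right)=\Gamma\left[{\frac12,\ \frac13a,\ 1+\frac13a,\ \frac23a-\frac32,\ \frac23a-2\atop \frac12a-\frac32,\ \frac16a,\ \frac12+\frac16a,\ 2-\frac16a,\ \frac43a-3}\right]$, 2. ${}_2F_1\left(a-\frac32,\frac14a+\frac14;\frac34a-\frac14;-1\right)=\Gamma\left[{\frac12,\ \frac32,\ \frac34+\frac14a,\ \frac12a,\ \frac34a-\frac14\atop \frac78,\ \frac98,\ a,\ \frac18+\frac14a,\ \frac38+\frac14a}\right]$, 3. ${}_2F_1\left(a-\frac12,\frac14a;\frac34a;-1\right)=\Gamma\left[{\frac12,\ \frac12,\ \frac12+\frac14a,\ \frac12+\frac12a,\ \frac34a\atop \frac38,\ \frac58,\ a,\ \frac38+\frac14a,\ \frac58+\frac14a}\right]$, 4. ${}_2F_1\left(a+2,\frac23a;\frac13a;-1\right)=\Gamma\left[{\frac12,\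 \frac13a,\ 1+\frac13a,\ \frac32+\frac23a,\ 2+\frac23a\atop \frac32+\frac12a,\ \frac12+\frac16a,\ 1+\frac16a,\ -\frac16a,\ 2+\frac43a}\right]$. In each of these, the left side is the (possibly only conditionally convergent) sum of the series $\sum_{k\ge0}\frac{(\cdot)_k(\cdot)_k}{(\cdot)_k\,k!}(-1)^k$, and it is assumed that the parametric excess (the lower parameter of the series minus the sum of its two upper parameters) has real part greater than $-1$, and that neither the lower parameter of the series nor any upper parameter of the gamma quotient is a non-positive integer. -/

import Mathlib

/-- The matrix `A` relating the coordinates `(x, y, z; u, v)`, in which Thomae's transformations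
are permutations, to the parameters `(a, b, c; d, e) = (x, y, z; u, v) A` of `₃F₂(a, b, c; d, e; 1)`. -/
def thomaeMatrix : Matrix (Fin 5) (Fin 5) ℂ :=
  !![1, 0, 0, 1, 1;
     0, 1, 0, 1, 1;
     0, 0, 1, 1, 1;
     1, 1, 1, 2, 1;
     1, 1, 1, 1, 2]

/-- Three times the inverse of `thomaeMatrix`. -/
def thomaeMatrixInv : Matrix (Fin 5) (Fin 5) ℂ :=
  !![1, -2, -2, 1, 1;
     -2, 1, -2, 1, 1;
     -2, -2, 1, 1, 1;
     1, 1, 1, 1, -2;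
     1, 1, 1, -2, 1]

/-- The linear change of coordinates `(x, y, z; u, v) ↦ (a, b, c; d, e) = (x, y, z; u, v) A`.
The parameter space `ℂ³ × ℂ²` of `₃F₂` is `Fin 5 → ℂ`, with entries `a, b, c, d, e` in this order. -/
noncomputable def thomaeCoord : (Fin 5 → ℂ) ≃ₗ[ℂ] (Fin 5 → ℂ) where
  toFun w := Matrix.vecMul w thomaeMatrix
  map_add' w w' := Matrix.add_vecMul _ _ _
  map_smul' t w := Matrix.smul_vecMul _ _ _
  invFun p := (1 / 3 : ℂ) • Matrix.vecMul p thomaeMatrixInv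
  left_inv w := by
    funext i
    fin_cases i <;>
      simp [thomaeMatrix, thomaeMatrixInv, Matrix.vecHead, Matrix.vecTail] <;> ring
  right_inv p := by
    funext i
    fin_cases i <;>
      simp [thomaeMatrix, thomaeMatrixInv, Matrix.vecHead, Matrix.vecTail] <;> ring

theorem thomaeCoord_apply (w : Fin 5 → ℂ) :
    thomaeCoord w = ![w 0 + w 3 + w 4, w 1 + w 3 + w 4, w 2 + w 3 + w 4,
      w 0 + w 1 + w 2 + 2 * w 3 + w 4, w 0 + w 1 + w 2 + w 3 + 2 * w 4] := by
  change Matrix.vecMul w thomaeMatrix = _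
  funext i
  fin_cases i <;>
    simp [thomaeMatrix, Matrix.vecHead, Matrix.vecTail] <;> ring

theorem thomaeCoord_symm_apply (p : Fin 5 → ℂ) :
    thomaeCoord.symm p = ![(p 0 - 2 * p 1 - 2 * p 2 + p 3 + p 4) / 3,
      (-2 * p 0 + p 1 - 2 * p 2 + p 3 + p 4) / 3, (-2 * p 0 - 2 * p 1 + p 2 + p 3 + p 4) / 3,
      (p 0 + p 1 + p 2 + p 3 - 2 * p 4) / 3, (p 0 + p 1 + p 2 - 2 * p 3 + p 4) / 3] := by
  change (1 / 3 : ℂ) • Matrix.vecMul p thomaeMatrixInv = _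
  funext i
  fin_cases i <;>
    simp [thomaeMatrixInv, Matrix.vecHead, Matrix.vecTail] <;> ring

/-- The action of `S₅` on the `₃F₂` parameter space: permute the coordinates `(x, y, z; u, v)`. -/
noncomputable def thomaeHom :
    Equiv.Perm (Fin 5) →* ((Fin 5 → ℂ) ≃ₗ[ℂ] (Fin 5 → ℂ)) where
  toFun σ := (thomaeCoord.symm.trans (LinearEquiv.funCongrLeft ℂ ℂ σ⁻¹)).trans thomaeCoord
  map_one' := by
    ext p i
    simp [LinearEquiv.funCongrLeft]
  map_mul' σ τ := by
    apply LinearEquiv.ext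
    intro p
    simp [LinearEquiv.mul_apply, LinearEquiv.funCongrLeft, LinearMap.funLeft, Function.comp_def]

/-- The Thomae group, a subgroup of `GL(5, ℂ)` isomorphic to `S₅`. -/
noncomputable def thomaeGroup : Subgroup ((Fin 5 → ℂ) ≃ₗ[ℂ] (Fin 5 → ℂ)) := thomaeHom.range

/-- The orbit under the Thomae group of a subset of the `₃F₂` parameter space. -/
def thomaeOrbit (V : Set (Fin 5 → ℂ)) : Set (Set (Fin 5 → ℂ)) :=
  {V' | ∃ T ∈ thomaeGroup, V' = T '' V}

/-- The `3`-plane of Dixon's formula, `₃F₂(a, b, c; 1 + a - b, 1 + a - c; 1)`. -/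
def dixonPlane : Set (Fin 5 → ℂ) := {p | p 3 = 1 + p 0 - p 1 ∧ p 4 = 1 + p 0 - p 2}

/-- The `3`-plane of Watson's formula, `₃F₂(a, b, c; (1 + a + b) / 2, 2 c; 1)`. -/
def watsonPlane : Set (Fin 5 → ℂ) := {p | p 3 = (1 + p 0 + p 1) / 2 ∧ p 4 = 2 * p 2}

/-- The `3`-plane of Whipple's formula, `₃F₂(a, 1 - a, c; e, 1 + 2 c - e; 1)`. -/
def whipplePlane : Set (Fin 5 → ℂ) := {p | p 1 = 1 - p 0 ∧ p 4 = 1 + 2 * p 2 - p 3}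

/-- The Dixon--Watson--Whipple orbit: the Thomae orbit of the Dixon `3`-plane.  It contains the
Watson and Whipple `3`-planes, see the two theorems that follow. -/
def dixonWatsonWhippleOrbit : Set (Set (Fin 5 → ℂ)) := thomaeOrbit dixonPlane

theorem watsonPlane_mem : watsonPlane ∈ dixonWatsonWhippleOrbit := by
  let σ : Equiv.Perm (Fin 5) := ⟨![4, 0, 2, 1, 3], ![1, 3, 2, 4, 0], by decide, by decide⟩
  refine ⟨thomaeHom σ, ⟨σ, rfl⟩, ?_⟩
  have hs : ∀ p, (thomaeHom σ).symm p =
      thomaeCoord (fun i => thomaeCoord.symm p (![4, 0, 2, 1, 3] i)) := fun p => rfl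
  ext p
  rw [LinearEquiv.image_eq_preimage_symm, Set.mem_preimage, hs]
  simp only [watsonPlane, dixonPlane, thomaeCoord_apply, thomaeCoord_symm_apply, Set.mem_ofPred_eq,
    Matrix.cons_val]
  constructor
  · rintro ⟨h₁, h₂⟩
    constructor <;> grind
  · rintro ⟨h₁, h₂⟩
    constructor <;> grind

theorem whipplePlane_mem : whipplePlane ∈ dixonWatsonWhippleOrbit := by
  let σ : Equiv.Perm (Fin 5) := ⟨![2, 0, 3, 1, 4], ![1, 3, 0, 2, 4], by decide, by decide⟩
  refine ⟨thomaeHom σ, ⟨σ, rfl⟩, ?_⟩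
  have hs : ∀ p, (thomaeHom σ).symm p =
      thomaeCoord (fun i => thomaeCoord.symm p (![2, 0, 3, 1, 4] i)) := fun p => rfl
  ext p
  rw [LinearEquiv.image_eq_preimage_symm, Set.mem_preimage, hs]
  simp only [whipplePlane, dixonPlane, thomaeCoord_apply, thomaeCoord_symm_apply, Set.mem_ofPred_eq,
    Matrix.cons_val]
  constructor
  · rintro ⟨h₁, h₂⟩
    constructor <;> grind
  · rintro ⟨h₁, h₂⟩
    constructor <;> grind

/-- The `3`-plane `W₀` of all `(α, α + 1/2, β; γ, γ + 1/2)`. -/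
def whippleBasePlane : Set (Fin 5 → ℂ) := {p | p 1 = p 0 + 1 / 2 ∧ p 4 = p 3 + 1 / 2}

/-- The Whipple `₂F₁(-1)` orbit. -/
def whippleTwoFOneOrbit : Set (Set (Fin 5 → ℂ)) := thomaeOrbit whippleBasePlane

/-- The map `(α, α + 1/2, β; γ, γ + 1/2) ↦ (2 α, β; 2 γ - β)` from `W₀` to the parameter space
`ℂ² × ℂ` of `₂F₁`, which is `Fin 3 → ℂ`, with entries `a, b, c` for `₂F₁(a, b; c; -1)`.  It comes
from Whipple's identity, by which `₂F₁(2 α, β; 2 γ - β; -1)` is a gamma quotient times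
`₃F₂(α, α + 1/2, β; γ, γ + 1/2; 1)`. -/
def whippleMap (p : Fin 5 → ℂ) : Fin 3 → ℂ := ![2 * p 0, p 2, 2 * p 3 - p 2]

/-- The non-empty intersections of a `3`-plane `D` on the Dixon--Watson--Whipple orbit and a
`3`-plane `W = T W₀` on the Whipple `₂F₁(-1)` orbit, projected to the `₂F₁` parameter space by
`whippleMap ∘ T⁻¹`; all choices of `T` are allowed. -/
def projectedIntersections : Set (Set (Fin 3 → ℂ)) :=
  {F | ∃ D ∈ dixonWatsonWhippleOrbit, ∃ W ∈ whippleTwoFOneOrbit, ∃ T ∈ thomaeGroup,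
    T '' whippleBasePlane = W ∧ (D ∩ W).Nonempty ∧
      F = (fun p => whippleMap (T⁻¹ p)) '' (D ∩ W)}

/-- Interchange of the two upper parameters, `(a, b; c) ↦ (b, a; c)`. -/
def upperSwap : Equiv.Perm (Fin 3 → ℂ) where
  toFun p := ![p 1, p 0, p 2]
  invFun p := ![p 1, p 0, p 2]
  left_inv p := by funext i; fin_cases i <;> simp
  right_inv p := by funext i; fin_cases i <;> simp

/-- Euler's transformation, `(a, b; c) ↦ (c - a, c - b; c)`. -/
def eulerTransformation : Equiv.Perm (Fin 3 → ℂ) where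
  toFun p := ![p 2 - p 0, p 2 - p 1, p 2]
  invFun p := ![p 2 - p 0, p 2 - p 1, p 2]
  left_inv p := by funext i; fin_cases i <;> simp
  right_inv p := by funext i; fin_cases i <;> simp

/-- The sets `V` and `V'` of `₂F₁` parameters agree up to separate permutations of upper and lower
parameters and up to Euler's transformation. -/
def EulerEquivalent (V V' : Set (Fin 3 → ℂ)) : Prop :=
  ∃ g ∈ Subgroup.closure {upperSwap, eulerTransformation}, V' = g '' V

/-- The Kummer `2`-plane, of all `(a, b; 1 + a - b)`. -/
def kummerPlane : Set (Fin 3 → ℂ) := {p | p 2 = 1 + p 0 - p 1}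

/-- Four parametrized lines in the `₂F₁` parameter space, each of the form `(a + ν, b; a - b)`
with `ν = -4, -3/2, -1/2, 2` respectively and `b` an affine function of `a`. -/
noncomputable def contiguousPoint : Fin 4 → ℂ → (Fin 3 → ℂ) :=
  ![fun a => ![a - 4, 2 / 3 * a - 1, 1 + 1 / 3 * a],
    fun a => ![a - 3 / 2, 1 / 4 * a + 1 / 4, 3 / 4 * a - 1 / 4],
    fun a => ![a - 1 / 2, 1 / 4 * a, 3 / 4 * a],
    fun a => ![a + 2, 2 / 3 * a, 1 / 3 * a]]

/-- The line in the `₂F₁` parameter space traced out by `contiguousPoint i`. -/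
def contiguousLine (i : Fin 4) : Set (Fin 3 → ℂ) := Set.range (contiguousPoint i)

/-- The gamma quotient with the given upper and lower parameters.  It vanishes if a lower parameter
is a non-positive integer, by Mathlib's conventions, which is the value of `1 / Γ` there. -/
noncomputable def gammaQuotient (upper lower : List ℂ) : ℂ :=
  (upper.map Complex.Gamma).prod / (lower.map Complex.Gamma).prod

/-- The series `₂F₁(a, b; c; -1)`, where `p = (a, b; c)`, converges (possibly only conditionally)
and its sum is `S`. -/
def TwoFOneNegOneHasSum (p : Fin 3 → ℂ) (S : ℂ) : Prop :=
  Filter.Tendsto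
    (fun N : ℕ => ∑ k ∈ Finset.range N,
      ordinaryHypergeometricCoefficient (p 0) (p 1) (p 2) k * (-1 : ℂ) ^ k)
    Filter.atTop (nhds S)

/-- The series `₂F₁(a, b; c; -1)`, where `p = (a, b; c)`, has the stated gamma quotient as its sum,
provided that its parametric excess has real part greater than `-1`, and that neither its lower
parameter nor any upper parameter of the gamma quotient is a non-positive integer. -/
def HasGammaEvaluation (p : Fin 3 → ℂ) (upper lower : List ℂ) : Prop :=
  -1 < (p 2 - p 0 - p 1).re → (∀ n : ℕ, p 2 ≠ -(n : ℂ)) →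
    (∀ x ∈ upper, ∀ n : ℕ, x ≠ -(n : ℂ)) →
      TwoFOneNegOneHasSum p (gammaQuotient upper lower)

/-! The classification is linear algebra over a finite set. In the coordinates (x, y, z; u, v) the
Dixon plane is y + u = z + v = 1/3, so its orbit consists of the 15 planes that prescribe the sum
1/3 on two disjoint pairs of the five coordinates. Applying T⁻¹ reduces every intersection to one
with W₀, on which y = x + 1/2 and v = u + 1/2 (`image_inter_eq_pairPlane`). Seven of the 15 pairings
land in the Kummer plane with its upper parameters interchanged: one fills it, one is empty, five
are lines. The other eight give lines, matched in twos by Euler's transformation composed with the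
interchange, which acts on W₀ as (x, y) ↔ (u, v). Two points per line and the four elements of the
group then separate the four classes.

For the evaluations, division by Γ(C) makes every term of ₂F₁(A, B; C; -1) entire in the parameters.
Where the excess has real part above -1, the coefficients are O(k^(-δ)) and their differences
O(k^(-1-δ)), locally uniformly, so the alternating sum is holomorphic (`differentiableOn_regSum`)
and each formula need only be checked on a real interval (`regSum_eq_of_eq_on_interval`). There
Euler's integral is available, and t = tan² φ turns it into the integral of 2 sin^(2b-1) φ ·
cos^(c-b-1) 2φ · cos^(2a-2c+1) φ over (0, π/4).

On the Kummer plane the exponents of sin φ and cos φ agree, and a beta integral results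
(`regSum_kummer`). The lines with ν = -4 and ν = 2 are contiguous to Kummer series, to which
explicit telescoping relations reduce them. On the lines with ν = -3/2 and ν = -1/2 the integrand is
a power of sin 4φ times sin φ or cos φ, and Cauchy's integral of cos^p u · cos(u/4) applies
(`cosIntegral_eq`). The duplication and reflection formulas convert the results into the stated
gamma quotients. -/

/-! ### Growth of the regularized coefficients. -/

open Complex Filter Topology in
/-- The `k`-th coefficient of the series `₂F₁(A, B; C; z) / Γ(C)`. -/
noncomputable def regCoeff (A B C : ℂ) (k : ℕ) : ℂ :=
  (ascPochhammer ℂ k).eval A * (ascPochhammer ℂ k).eval B * ((k.factorial : ℂ)⁻¹ * (Gamma (C + k))⁻¹)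

theorem regCoeff_succ_mul (A B C : ℂ) (k : ℕ) :
    regCoeff A B C (k + 1) * ((C + k) * (k + 1)) = regCoeff A B C k * ((A + k) * (B + k)) := by
  have h := Complex.one_div_Gamma_eq_self_mul_one_div_Gamma_add_one (C + k)
  have hk : (k : ℂ) + 1 ≠ 0 := by exact_mod_cast k.succ_ne_zero
  have hk' : (k.factorial : ℂ) ≠ 0 := by exact_mod_cast k.factorial_ne_zero
  simp only [regCoeff, ascPochhammer_succ_eval, Nat.factorial_succ]
  rw [h]
  push_cast
  rw [← add_assoc]
  field_simp

/-- The cubic inequality behind the bound on the ratio of consecutive coefficients. -/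
theorem cubic_ratio_bound {R δ k α β γ : ℝ} (hR : 1 ≤ R) (hδ : 0 < δ) (hδ1 : δ ≤ 1)
    (hk : 15 * R ^ 2 ≤ k * δ) (hα : |α| ≤ R) (hβ : |β| ≤ R) (hγ : |γ| ≤ R)
    (h : α + β + 2 * δ ≤ γ + 1) :
    (k + α + R ^ 2 / k) * (k + β + R ^ 2 / k) * (k + δ) ≤ k * ((k + γ) * (k + 1)) := by
  have hR2 : 1 ≤ R ^ 2 := one_le_pow₀ hR
  have hk0 : 0 < k := pos_of_mul_pos_left (by linarith) hδ.le
  have hk15 : 15 ≤ k := by nlinarith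
  obtain ⟨ε, hε⟩ : ∃ ε, ε = R ^ 2 / k := ⟨_, rfl⟩
  rw [← hε]
  have hεk : ε * k = R ^ 2 := by rw [hε]; field_simp
  have hε0 : 0 ≤ ε := by rw [hε]; positivity
  have hεR : ε ≤ R := by nlinarith
  rw [abs_le] at hα hβ hγ
  have h1 : (α + ε) * (β + ε) ≤ 4 * R ^ 2 := by
    have h2 : |α + ε| ≤ 2 * R := abs_le.2 ⟨by linarith, by linarith⟩
    have h3 : |β + ε| ≤ 2 * R := abs_le.2 ⟨by linarith, by linarith⟩
    calc (α + ε) * (β + ε) ≤ |(α + ε) * (β + ε)| := le_abs_self _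
      _ = |α + ε| * |β + ε| := abs_mul _ _
      _ ≤ (2 * R) * (2 * R) := by gcongr
      _ = 4 * R ^ 2 := by ring
  have h2 : δ * (α + β + 2 * ε) ≤ 4 * R ^ 2 := by nlinarith
  have h3 : δ * ((α + ε) * (β + ε)) ≤ 4 * R ^ 2 * k := by nlinarith
  have h4 : k * ((α + ε) * (β + ε) + δ * (α + β + 2 * ε)) ≤ k * (8 * R ^ 2) := by gcongr; linarith
  have h5 : k ^ 2 * (α + β + 2 * δ) ≤ k ^ 2 * (γ + 1) := by gcongr
  have h6 : k * (15 * R ^ 2) ≤ k * (k * δ) := by gcongr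
  have hRR : R ≤ R ^ 2 := by nlinarith
  have h7 : k * -(R ^ 2) ≤ k * γ := by gcongr; linarith
  have h8 : k ^ 2 * ε = k * R ^ 2 := by rw [← hεk]; ring
  -- The cubes cancel, and `h` leaves a margin δk² ≥ 15R²k among the squares. It pays 2R²k for the
  -- two terms in ε, 8R²k for the linear terms, 4R²k for the constant term and R²k for kγ; this is
  -- where 15 comes from.
  nlinarith

/-- To first order only Re A contributes to |A + k|, and Im A enters through |A|²/k. The bound k +
|A| would be too weak to reach the sharp condition on the real part of the excess. -/
theorem norm_add_natCast_le {R k : ℝ} (hk : 2 * R ≤ k) (hk0 : 0 < k) {A : ℂ} (hA : ‖A‖ ≤ R) :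
    ‖A + k‖ ≤ k + A.re + R ^ 2 / k := by
  have h1 := (Complex.abs_re_le_norm A).trans hA
  rw [abs_le] at h1
  have h0 : 0 ≤ R ^ 2 / k := by positivity
  have h2 : ‖A‖ ^ 2 ≤ R ^ 2 := by gcongr
  rw [← Complex.normSq_eq_norm_sq, Complex.normSq_apply] at h2
  have h3 : R ^ 2 / k * k = R ^ 2 := by field_simp
  refine abs_le_of_sq_le_sq' ?_ (by linarith) |>.2
  rw [← Complex.normSq_eq_norm_sq, Complex.normSq_apply]
  simp only [Complex.add_re, Complex.ofReal_re, Complex.add_im, Complex.ofReal_im]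
  nlinarith [mul_nonneg h0 (show 0 ≤ k + 2 * A.re by linarith), sq_nonneg A.re]

theorem le_norm_add_natCast (k : ℝ) (A : ℂ) : k + A.re ≤ ‖A + k‖ := by
  have := Complex.re_le_norm (A + k)
  simp only [Complex.add_re, Complex.ofReal_re] at this
  linarith

/-- A bound for `‖regCoeff A B C k‖ * k ^ δ` as soon as `k` is large, uniformly in the parameters. -/
theorem norm_regCoeff_succ_le {R δ : ℝ} (hR : 1 ≤ R) (hδ : 0 < δ) (hδ1 : δ ≤ 1) {A B C : ℂ}
    (hA : ‖A‖ ≤ R) (hB : ‖B‖ ≤ R) (hC : ‖C‖ ≤ R) (h : 2 * δ ≤ (C - A - B).re + 1) {k : ℕ}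
    (hk : 15 * R ^ 2 ≤ k * δ) :
    ‖regCoeff A B C (k + 1)‖ * ((k + 1 : ℕ) : ℝ) ^ δ ≤ ‖regCoeff A B C k‖ * (k : ℝ) ^ δ := by
  have hR2 : 1 ≤ R ^ 2 := one_le_pow₀ hR
  have hk0 : (0 : ℝ) < k := pos_of_mul_pos_left (by linarith) hδ.le
  have hkR : 2 * R ≤ k := by nlinarith
  have hreA := (Complex.abs_re_le_norm A).trans hA
  have hreB := (Complex.abs_re_le_norm B).trans hB
  have hreC := (Complex.abs_re_le_norm C).trans hC
  have hcub := cubic_ratio_bound (k := k) hR hδ hδ1 hk hreA hreB hreC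
    (by simp only [Complex.sub_re] at h; linarith)
  have hrec := congrArg norm (regCoeff_succ_mul A B C k)
  simp only [norm_mul] at hrec
  have hk1 : ‖(k : ℂ) + 1‖ = k + 1 := by
    rw [show (k : ℂ) + 1 = ((k + 1 : ℕ) : ℂ) by push_cast; rfl, Complex.norm_natCast]; push_cast; rfl
  have hAk := norm_add_natCast_le hkR hk0 hA
  have hBk := norm_add_natCast_le hkR hk0 hB
  have hCk := le_norm_add_natCast k C
  rw [Complex.ofReal_natCast] at hAk hBk hCk
  rw [hk1] at hrec
  have hCpos : 0 < k + C.re := by have := (abs_le.1 hreC).1; linarith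
  -- Bernoulli's inequality for exponents at most 1; it replaces the power by the third factor of
  -- the cubic inequality.
  have hpow : ((k + 1 : ℕ) : ℝ) ^ δ ≤ (k : ℝ) ^ δ * ((k + δ) / k) := by
    have h1 : ((k + 1 : ℕ) : ℝ) = k * (1 + 1 / k) := by push_cast; field_simp
    have h2 := rpow_one_add_le_one_add_mul_self (s := 1 / (k : ℝ)) (p := δ)
      (by have : 0 ≤ 1 / (k : ℝ) := by positivity
          linarith) hδ.le hδ1
    rw [h1, Real.mul_rpow hk0.le (by positivity)]
    gcongr
    refine h2.trans (le_of_eq ?_)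
    field_simp
  have hden : 0 < ‖C + k‖ * (k + 1 : ℝ) := mul_pos (hCpos.trans_le hCk) (by positivity)
  refine le_of_mul_le_mul_right ?_ hden
  calc ‖regCoeff A B C (k + 1)‖ * ((k + 1 : ℕ) : ℝ) ^ δ * (‖C + k‖ * (k + 1 : ℝ))
      = ‖regCoeff A B C k‖ * (‖A + k‖ * ‖B + k‖) * ((k + 1 : ℕ) : ℝ) ^ δ := by rw [← hrec]; ring
    _ ≤ ‖regCoeff A B C k‖ * ((k + A.re + R ^ 2 / k) * (k + B.re + R ^ 2 / k)) *
        ((k : ℝ) ^ δ * ((k + δ) / k)) := by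
        have := (norm_nonneg _).trans hAk
        have := (norm_nonneg _).trans hBk
        gcongr
    _ = ‖regCoeff A B C k‖ * (k : ℝ) ^ δ *
        (((k + A.re + R ^ 2 / k) * (k + B.re + R ^ 2 / k) * (k + δ)) / k) := by ring
    _ ≤ ‖regCoeff A B C k‖ * (k : ℝ) ^ δ * (‖C + k‖ * (k + 1 : ℝ)) := by
        gcongr
        rw [div_le_iff₀ hk0]
        refine hcub.trans ?_
        rw [mul_comm]
        gcongr

theorem norm_regCoeff_le {R δ : ℝ} (hR : 1 ≤ R) (hδ : 0 < δ) (hδ1 : δ ≤ 1) {A B C : ℂ}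
    (hA : ‖A‖ ≤ R) (hB : ‖B‖ ≤ R) (hC : ‖C‖ ≤ R) (h : 2 * δ ≤ (C - A - B).re + 1) {K : ℕ}
    (hK : 15 * R ^ 2 ≤ K * δ) {k : ℕ} (hk : K ≤ k) :
    ‖regCoeff A B C k‖ ≤ ‖regCoeff A B C K‖ * (K : ℝ) ^ δ * (k : ℝ) ^ (-δ) := by
  have hR2 : 1 ≤ R ^ 2 := one_le_pow₀ hR
  have hk0 : (0 : ℝ) < K := pos_of_mul_pos_left (by linarith) hδ.le
  have hk1 : (0 : ℝ) < k := hk0.trans_le (by exact_mod_cast hk)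
  have key : ‖regCoeff A B C k‖ * (k : ℝ) ^ δ ≤ ‖regCoeff A B C K‖ * (K : ℝ) ^ δ := by
    induction k, hk using Nat.le_induction with
    | base => exact le_rfl
    | succ n hn ih =>
      have hn0 : (K : ℝ) ≤ n := by exact_mod_cast hn
      refine (norm_regCoeff_succ_le hR hδ hδ1 hA hB hC h (hK.trans ?_)).trans
        (ih (hk0.trans_le hn0))
      gcongr
  rw [Real.rpow_neg hk1.le, ← div_eq_mul_inv, le_div_iff₀ (by positivity)]
  exact key

/-- In (C + k)(k + 1) - (A + k)(B + k) the squares of k cancel, so differencing gains a factor 1/k.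
The constant 12R² is 6R² from the remaining linear numerator, doubled because |C + k| ≥ k/2. -/
theorem norm_regCoeff_sub_le {R δ : ℝ} (hR : 1 ≤ R) (hδ : 0 < δ) (hδ1 : δ ≤ 1) {A B C : ℂ}
    (hA : ‖A‖ ≤ R) (hB : ‖B‖ ≤ R) (hC : ‖C‖ ≤ R) (h : 2 * δ ≤ (C - A - B).re + 1) {K : ℕ}
    (hK : 15 * R ^ 2 ≤ K * δ) {k : ℕ} (hk : K ≤ k) :
    ‖regCoeff A B C k - regCoeff A B C (k + 1)‖ ≤
      ‖regCoeff A B C K‖ * (K : ℝ) ^ δ * (12 * R ^ 2) * (k : ℝ) ^ (-1 - δ) := by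
  have hR2 : 1 ≤ R ^ 2 := one_le_pow₀ hR
  have hK0 : (0 : ℝ) < K := pos_of_mul_pos_left (by linarith) hδ.le
  have hKk : (K : ℝ) ≤ k := by exact_mod_cast hk
  have hk0 : (0 : ℝ) < k := hK0.trans_le hKk
  have hkR : 2 * R ≤ k := by nlinarith
  have hreC := (Complex.abs_re_le_norm C).trans hC
  have hCk := le_norm_add_natCast k C
  rw [Complex.ofReal_natCast] at hCk
  have hCk2 : (k : ℝ) / 2 ≤ ‖C + k‖ := by have := (abs_le.1 hreC).1; linarith
  have hC0 : C + k ≠ 0 := norm_pos_iff.1 (by linarith)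
  have hk1 : ‖(k : ℂ) + 1‖ = k + 1 := by
    rw [show (k : ℂ) + 1 = ((k + 1 : ℕ) : ℂ) by push_cast; rfl, Complex.norm_natCast]; push_cast; rfl
  have hk10 : (k : ℂ) + 1 ≠ 0 := norm_pos_iff.1 (by rw [hk1]; positivity)
  have hrec := regCoeff_succ_mul A B C k
  have hsub : (regCoeff A B C k - regCoeff A B C (k + 1)) * ((C + k) * (k + 1)) =
      regCoeff A B C k * ((C + 1 - A - B) * k + C - A * B) := by
    rw [sub_mul, hrec]; ring
  have hnum : ‖(C + 1 - A - B) * k + C - A * B‖ ≤ 6 * R ^ 2 * (k + 1) := by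
    calc ‖(C + 1 - A - B) * k + C - A * B‖ ≤ (‖C‖ + 1 + ‖A‖ + ‖B‖) * k + ‖C‖ + ‖A‖ * ‖B‖ := by
          refine (norm_sub_le _ _).trans ?_
          rw [norm_mul]
          gcongr
          refine (norm_add_le _ _).trans ?_
          rw [norm_mul, Complex.norm_natCast]
          gcongr
          refine (norm_sub_le _ _).trans ?_
          gcongr
          refine (norm_sub_le _ _).trans ?_
          gcongr
          refine (norm_add_le _ _).trans ?_
          simp
      _ ≤ (R + 1 + R + R) * k + R + R * R := by gcongr
      _ = (3 * R + 1) * k + (R + R ^ 2) := by ring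
      _ ≤ (6 * R ^ 2) * k + 6 * R ^ 2 := by gcongr <;> nlinarith
      _ = 6 * R ^ 2 * (k + 1) := by ring
  have hn := congrArg norm hsub
  rw [norm_mul, norm_mul, norm_mul, hk1] at hn
  have h1 : ‖regCoeff A B C k - regCoeff A B C (k + 1)‖ * (k / 2 * (k + 1)) ≤
      ‖regCoeff A B C k‖ * (6 * R ^ 2 * (k + 1)) :=
    calc _ ≤ ‖regCoeff A B C k - regCoeff A B C (k + 1)‖ * (‖C + k‖ * (k + 1)) := by gcongr
      _ ≤ _ := by rw [hn]; gcongr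
  have h2 : ‖regCoeff A B C k - regCoeff A B C (k + 1)‖ ≤
      ‖regCoeff A B C k‖ * (12 * R ^ 2) * (k : ℝ)⁻¹ := by
    rw [← div_eq_mul_inv, le_div_iff₀ hk0]
    have : (0 : ℝ) < k + 1 := by positivity
    refine le_of_mul_le_mul_right (a := ((k : ℝ) + 1) / 2) ?_ (by positivity)
    linarith
  refine h2.trans ?_
  have h3 := norm_regCoeff_le hR hδ hδ1 hA hB hC h hK hk
  rw [show -1 - δ = -δ + -1 by ring, Real.rpow_add hk0, Real.rpow_neg_one]
  calc _ ≤ ‖regCoeff A B C K‖ * (K : ℝ) ^ δ * (k : ℝ) ^ (-δ) * (12 * R ^ 2) * (k : ℝ)⁻¹ := by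
        gcongr
    _ = _ := by ring

/-! ### Summation of the series and holomorphy in the parameters. -/

/-- Summation by parts: a conditionally convergent alternating sum becomes a boundary term plus a
sum of differences, which converges absolutely. This is the shape used to define `regSum`. -/
theorem sum_alternating (t : ℕ → ℂ) (N : ℕ) :
    ∑ k ∈ Finset.range N, t k * (-1) ^ k =
      t 0 / 2 - t N * (-1) ^ N / 2 +
        (∑ k ∈ Finset.range N, (t k - t (k + 1)) * (-1) ^ k) / 2 := by
  induction N with
  | zero => simp
  | succ n ih => rw [Finset.sum_range_succ, Finset.sum_range_succ, ih, pow_succ]; ring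

open Filter Topology in
-- The coefficient bounds depend on the parameters only through R, δ and K, so fixing these on a
-- neighbourhood makes the bounds locally uniform.
theorem exists_bound_nhds {A B C : ℂ → ℂ} (hA : Continuous A) (hB : Continuous B)
    (hC : Continuous C) {z : ℂ} (hz : -1 < (C z - A z - B z).re) :
    ∃ U : Set ℂ, IsOpen U ∧ z ∈ U ∧ ∃ R δ : ℝ, 1 ≤ R ∧ 0 < δ ∧ δ ≤ 1 ∧ ∃ K : ℕ,
      15 * R ^ 2 ≤ K * δ ∧ ∀ w ∈ U, ‖A w‖ ≤ R ∧ ‖B w‖ ≤ R ∧ ‖C w‖ ≤ R ∧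
        2 * δ ≤ (C w - A w - B w).re + 1 := by
  obtain ⟨δ, hδ, hδ1, hδz⟩ : ∃ δ : ℝ, 0 < δ ∧ δ ≤ 1 ∧ 2 * δ < (C z - A z - B z).re + 1 := by
    refine ⟨min 1 (((C z - A z - B z).re + 1) / 4), ?_, min_le_left _ _, ?_⟩
    · exact lt_min one_pos (by linarith)
    · have := min_le_right 1 (((C z - A z - B z).re + 1) / 4)
      linarith
  obtain ⟨R, hR⟩ : ∃ R : ℝ, R = 1 + ‖A z‖ + ‖B z‖ + ‖C z‖ := ⟨_, rfl⟩
  have hR1 : 1 ≤ R := by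
    have := norm_nonneg (A z); have := norm_nonneg (B z); have := norm_nonneg (C z); linarith
  obtain ⟨K, hK⟩ := exists_nat_ge (15 * R ^ 2 / δ)
  rw [div_le_iff₀ hδ] at hK
  refine ⟨{w | ‖A w‖ < R} ∩ {w | ‖B w‖ < R} ∩ {w | ‖C w‖ < R} ∩
    {w | 2 * δ < (C w - A w - B w).re + 1}, ?_, ?_, R, δ, hR1, hδ, hδ1, K, hK, ?_⟩
  · refine ((IsOpen.inter ?_ ?_).inter ?_).inter ?_
    · exact isOpen_lt (by fun_prop) (by fun_prop)
    · exact isOpen_lt (by fun_prop) (by fun_prop)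
    · exact isOpen_lt (by fun_prop) (by fun_prop)
    · exact isOpen_lt (by fun_prop) (by fun_prop)
  · have := norm_nonneg (A z); have := norm_nonneg (B z); have := norm_nonneg (C z)
    exact ⟨⟨⟨show ‖A z‖ < R by linarith, show ‖B z‖ < R by linarith⟩,
      show ‖C z‖ < R by linarith⟩, hδz⟩
  · rintro w ⟨⟨⟨h1, h2⟩, h3⟩, h4⟩
    exact ⟨le_of_lt h1, le_of_lt h2, le_of_lt h3, le_of_lt h4⟩

open Filter Topology in
theorem tendsto_regCoeff_zero {A B C : ℂ} (h : -1 < (C - A - B).re) :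
    Tendsto (regCoeff A B C) atTop (𝓝 0) := by
  obtain ⟨U, -, hzU, R, δ, hR, hδ, hδ1, K, hK, hU⟩ := exists_bound_nhds (A := fun _ => A)
    (B := fun _ => B) (C := fun _ => C) (z := 0) continuous_const continuous_const
    continuous_const h
  obtain ⟨h1, h2, h3, h4⟩ := hU 0 hzU
  refine squeeze_zero_norm' (a := fun k : ℕ => ‖regCoeff A B C K‖ * (K : ℝ) ^ δ * (k : ℝ) ^ (-δ))
    ?_ ?_
  · filter_upwards [eventually_ge_atTop K] with k hk
    exact norm_regCoeff_le hR hδ hδ1 h1 h2 h3 h4 hK hk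
  · have := (tendsto_rpow_neg_atTop hδ).comp (tendsto_natCast_atTop_atTop (R := ℝ))
    simpa using this.const_mul (‖regCoeff A B C K‖ * (K : ℝ) ^ δ)

/-- The sum of the series `₂F₁(A, B; C; -1) / Γ(C)`. -/
noncomputable def regSum (A B C : ℂ) : ℂ :=
  regCoeff A B C 0 / 2 + (∑' k, (regCoeff A B C k - regCoeff A B C (k + 1)) * (-1) ^ k) / 2

theorem summable_regCoeff_sub {A B C : ℂ} (h : -1 < (C - A - B).re) :
    Summable fun k => (regCoeff A B C k - regCoeff A B C (k + 1)) * (-1) ^ k := by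
  obtain ⟨U, -, hzU, R, δ, hR, hδ, hδ1, K, hK, hU⟩ := exists_bound_nhds (A := fun _ => A)
    (B := fun _ => B) (C := fun _ => C) (z := 0) continuous_const continuous_const
    continuous_const h
  obtain ⟨h1, h2, h3, h4⟩ := hU 0 hzU
  refine Summable.of_norm_bounded_eventually_nat
    (g := fun k : ℕ => ‖regCoeff A B C K‖ * (K : ℝ) ^ δ * (12 * R ^ 2) * (k : ℝ) ^ (-1 - δ)) ?_ ?_
  · exact (Real.summable_nat_rpow.2 (by linarith)).mul_left _
  · filter_upwards [Filter.eventually_ge_atTop K] with k hk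
    rw [norm_mul, norm_pow, norm_neg, norm_one, one_pow, mul_one]
    exact norm_regCoeff_sub_le hR hδ hδ1 h1 h2 h3 h4 hK hk

open Filter Topology in
theorem tendsto_regSum {A B C : ℂ} (h : -1 < (C - A - B).re) :
    Tendsto (fun N => ∑ k ∈ Finset.range N, regCoeff A B C k * (-1) ^ k) atTop
      (𝓝 (regSum A B C)) := by
  have h0 := funext (sum_alternating (regCoeff A B C))
  rw [h0]
  have h1 := (summable_regCoeff_sub h).hasSum.tendsto_sum_nat
  have h2 : Tendsto (fun N => regCoeff A B C N * (-1) ^ N / 2) atTop (𝓝 0) := by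
    have := tendsto_regCoeff_zero h
    rw [tendsto_zero_iff_norm_tendsto_zero] at this ⊢
    simpa using this.div_const 2
  simpa [regSum] using (tendsto_const_nhds.sub h2).add (h1.div_const 2)

theorem differentiable_regCoeff {A B C : ℂ → ℂ} (hA : Differentiable ℂ A)
    (hB : Differentiable ℂ B) (hC : Differentiable ℂ C) (k : ℕ) :
    Differentiable ℂ fun z => regCoeff (A z) (B z) (C z) k := by
  unfold regCoeff
  have h1 : Differentiable ℂ fun z => (Complex.Gamma (C z + k))⁻¹ :=
    Complex.differentiable_one_div_Gamma.comp (hC.add_const _)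
  have h2 : Differentiable ℂ fun z => (ascPochhammer ℂ k).eval (A z) :=
    (Polynomial.differentiable (ascPochhammer ℂ k)).comp hA
  have h3 : Differentiable ℂ fun z => (ascPochhammer ℂ k).eval (B z) :=
    (Polynomial.differentiable (ascPochhammer ℂ k)).comp hB
  exact (h2.mul h3).mul (h1.const_mul _)

open Filter Topology in
-- Weierstrass' theorem for the absolutely convergent series of differences.
theorem differentiableOn_regSum {A B C : ℂ → ℂ} (hA : Differentiable ℂ A)
    (hB : Differentiable ℂ B) (hC : Differentiable ℂ C) :
    DifferentiableOn ℂ (fun z => regSum (A z) (B z) (C z)) {z | -1 < (C z - A z - B z).re} := by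
  intro z hz
  obtain ⟨U, hUo, hzU, R, δ, hR, hδ, hδ1, K, hK, hU⟩ :=
    exists_bound_nhds hA.continuous hB.continuous hC.continuous hz
  have hd := fun k => differentiable_regCoeff hA hB hC k
  have hterm : ∀ k : ℕ, Differentiable ℂ fun w => (regCoeff (A w) (B w) (C w) k -
      regCoeff (A w) (B w) (C w) (k + 1)) * (-1) ^ k :=
    fun k => ((hd k).sub (hd (k + 1))).mul_const _
  obtain ⟨r, hr, hrU⟩ := Metric.isOpen_iff.1 hUo z hzU
  have hbd : ∀ f : ℂ → ℂ, Continuous f → ∃ M, ∀ w ∈ Metric.ball z r, ‖f w‖ ≤ M := by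
    intro f hf
    obtain ⟨M, hM⟩ := (isCompact_closedBall z r).exists_bound_of_continuousOn hf.continuousOn
    exact ⟨M, fun w hw => hM w (Metric.ball_subset_closedBall hw)⟩
  choose M hM using fun k => hbd _ (hterm k).continuous
  obtain ⟨L, hL⟩ := hbd _ (hd K).continuous
  have hmain : DifferentiableOn ℂ (fun w => ∑' k, (regCoeff (A w) (B w) (C w) k -
      regCoeff (A w) (B w) (C w) (k + 1)) * (-1) ^ k) (Metric.ball z r) := by
    -- The decay estimate starts only at index K. The finitely many earlier terms are bounded by
    -- compactness of the closed ball, and so is the coefficient at K, by L.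
    refine Complex.differentiableOn_tsum_of_summable_norm
      (u := fun k : ℕ => if k < K then M k else
        L * (K : ℝ) ^ δ * (12 * R ^ 2) * (k : ℝ) ^ (-1 - δ)) ?_
      (fun k => (hterm k).differentiableOn) Metric.isOpen_ball ?_
    · refine (summable_congr_atTop ?_).1 ((Real.summable_nat_rpow.2
        (show -1 - δ < -1 by linarith)).mul_left (L * (K : ℝ) ^ δ * (12 * R ^ 2)))
      filter_upwards [eventually_ge_atTop K] with k hk
      rw [if_neg (not_lt.2 hk)]
    · intro k w hw
      split_ifs with hk
      · exact hM k w hw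
      · obtain ⟨h1, h2, h3, h4⟩ := hU w (hrU hw)
        rw [norm_mul, norm_pow, norm_neg, norm_one, one_pow, mul_one]
        refine (norm_regCoeff_sub_le hR hδ hδ1 h1 h2 h3 h4 hK (not_lt.1 hk)).trans ?_
        gcongr
        exact hL w hw
  exact ((hd 0).differentiableAt.div_const 2 |>.add
    ((hmain.differentiableAt (Metric.ball_mem_nhds z hr)).div_const 2)).differentiableWithinAt

theorem coefficient_eq_Gamma_mul_regCoeff {A B C : ℂ} (hC : ∀ n : ℕ, C ≠ -(n : ℂ)) (k : ℕ) :
    ordinaryHypergeometricCoefficient A B C k = Complex.Gamma C * regCoeff A B C k := by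
  have h : Complex.Gamma (C + k) = Complex.Gamma C * (ascPochhammer ℂ k).eval C := by
    induction k with
    | zero => simp
    | succ n ih =>
      have hne : C + n ≠ 0 := fun h => hC n (eq_neg_of_add_eq_zero_left h)
      rw [ascPochhammer_succ_eval, ← mul_assoc, ← ih]
      push_cast
      rw [← add_assoc, Complex.Gamma_add_one _ hne, mul_comm]
  have h0 := Complex.Gamma_ne_zero hC
  rw [regCoeff, h, ordinaryHypergeometricCoefficient]
  field_simp

theorem twoFOneNegOneHasSum_of_regSum {p : Fin 3 → ℂ} (h : -1 < (p 2 - p 0 - p 1).re)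
    (hC : ∀ n : ℕ, p 2 ≠ -(n : ℂ)) :
    TwoFOneNegOneHasSum p (Complex.Gamma (p 2) * regSum (p 0) (p 1) (p 2)) := by
  unfold TwoFOneNegOneHasSum
  simp_rw [coefficient_eq_Gamma_mul_regCoeff hC, mul_assoc, ← Finset.mul_sum]
  exact (tendsto_regSum h).const_mul _

/-! ### Euler's integral at argument -1. -/

theorem choose_neg_eq_ascPochhammer (A : ℂ) (n : ℕ) :
    Ring.choose (-A) n = (-1) ^ n * ((ascPochhammer ℂ n).eval A * (n.factorial : ℂ)⁻¹) := by
  have hn : (n.factorial : ℂ) ≠ 0 := by exact_mod_cast n.factorial_ne_zero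
  have h := Ring.descPochhammer_eq_factorial_smul_choose (-A) n
  have h2 : (descPochhammer ℤ n).smeval (-A) = (-1) ^ n * (ascPochhammer ℂ n).eval A := by
    clear h hn
    induction n with
    | zero => simp [Polynomial.smeval_one]
    | succ m ih =>
      rw [descPochhammer_succ_right, Polynomial.smeval_mul, ih, Polynomial.smeval_sub,
        Polynomial.smeval_X, Polynomial.smeval_natCast, ascPochhammer_succ_eval]
      simp
      ring
  rw [h2, nsmul_eq_mul] at h
  rw [← mul_assoc, h]
  field_simp

theorem hasSum_binomial (A : ℂ) {x : ℂ} (hx : ‖x‖ < 1) :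
    HasSum (fun n : ℕ => (ascPochhammer ℂ n).eval A * (n.factorial : ℂ)⁻¹ * (-x) ^ n)
      ((1 + x) ^ (-A)) := by
  have h := (Complex.one_add_cpow_hasFPowerSeriesOnBall_zero (a := -A)).hasSum
    (y := x) (by simpa [← ofReal_norm] using hx)
  rw [zero_add] at h
  have h1 : (fun n : ℕ => (ascPochhammer ℂ n).eval A * (n.factorial : ℂ)⁻¹ * (-x) ^ n) =
      fun n => (binomialSeries ℂ (-A) n) fun _ => x := by
    funext n
    rw [binomialSeries_apply, choose_neg_eq_ascPochhammer, neg_pow x]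
    simp
    ring
  rw [h1]
  exact h

theorem summable_norm_binomial (A : ℂ) {r : ℝ} (hr0 : 0 ≤ r) (hr : r < 1) :
    Summable fun n : ℕ => ‖(ascPochhammer ℂ n).eval A * (n.factorial : ℂ)⁻¹‖ * r ^ n := by
  have h := (hasSum_binomial A (x := -(r : ℂ)) (by simpa [abs_of_nonneg hr0] using hr)).summable.norm
  simpa [abs_of_nonneg hr0] using h

open Complex in
-- (B)ₖ / Γ(C + k) is a beta integral divided by Γ(B)Γ(C - B); this is Euler's integral term by
-- term.
theorem regCoeff_mul_Gamma_eq_betaIntegral (A : ℂ) {B C : ℂ} (hB : 0 < B.re) (hC : B.re < C.re)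
    (k : ℕ) :
    regCoeff A B C k * (Gamma B * Gamma (C - B)) =
      (ascPochhammer ℂ k).eval A * (k.factorial : ℂ)⁻¹ * betaIntegral (B + k) (C - B) := by
  have hpoch : Gamma (B + k) = Gamma B * (ascPochhammer ℂ k).eval B := by
    induction k with
    | zero => simp
    | succ n ih =>
      have hne : B + n ≠ 0 := by
        intro h
        have := congrArg re h
        simp only [add_re, natCast_re, zero_re] at this
        have : (0 : ℝ) ≤ n := n.cast_nonneg
        linarith
      rw [ascPochhammer_succ_eval, ← mul_assoc, ← ih]
      push_cast
      rw [← add_assoc, Gamma_add_one _ hne, mul_comm]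
  rw [betaIntegral_eq_Gamma_mul_div _ _
    (by have : (0 : ℝ) ≤ k := k.cast_nonneg
        simp only [add_re, natCast_re]; linarith) (by simpa using hC), hpoch, regCoeff,
    show B + k + (C - B) = C + k by ring]
  ring

open Complex Filter Topology MeasureTheory intervalIntegral in
/-- Euler's integral for the function `₂F₁(A, B; C; -r)`. -/
theorem hasSum_euler_integral (A : ℂ) {B C : ℂ} (hB : 0 < B.re) (hC : B.re < C.re) {r : ℝ}
    (hr0 : 0 ≤ r) (hr : r < 1) :
    HasSum (fun k => regCoeff A B C k * (-1) ^ k * (r : ℂ) ^ k * (Gamma B * Gamma (C - B)))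
      (∫ t in (0 : ℝ)..1, (t : ℂ) ^ (B - 1) * (1 - (t : ℂ)) ^ (C - B - 1) *
        (1 + (r * t : ℝ)) ^ (-A)) := by
  have hw : IntervalIntegrable (fun t : ℝ => (t : ℂ) ^ (B - 1) * (1 - (t : ℂ)) ^ (C - B - 1))
    volume 0 1 := betaIntegral_convergent hB (by simpa using hC)
  have key := hasSum_integral_of_dominated_convergence (μ := volume) (a := 0) (b := 1)
    (F := fun (k : ℕ) (t : ℝ) => (t : ℂ) ^ (B - 1) * (1 - (t : ℂ)) ^ (C - B - 1) *
      ((ascPochhammer ℂ k).eval A * (k.factorial : ℂ)⁻¹ * (-((r * t : ℝ) : ℂ)) ^ k))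
    (f := fun t => (t : ℂ) ^ (B - 1) * (1 - (t : ℂ)) ^ (C - B - 1) * (1 + (r * t : ℝ)) ^ (-A))
    (fun k t => ‖(t : ℂ) ^ (B - 1) * (1 - (t : ℂ)) ^ (C - B - 1)‖ *
      (‖(ascPochhammer ℂ k).eval A * (k.factorial : ℂ)⁻¹‖ * r ^ k)) ?_ ?_ ?_ ?_ ?_
  · refine (congrArg (HasSum · _) (funext fun k => ?_)).mp key
    symm
    have h1 := regCoeff_mul_Gamma_eq_betaIntegral A hB hC k
    rw [show regCoeff A B C k * (-1) ^ k * (r : ℂ) ^ k * (Gamma B * Gamma (C - B)) =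
      (-1) ^ k * (r : ℂ) ^ k * (regCoeff A B C k * (Gamma B * Gamma (C - B))) by ring, h1,
      betaIntegral, ← intervalIntegral.integral_const_mul, ← intervalIntegral.integral_const_mul]
    refine integral_congr_Ioo_of_le zero_le_one fun t ht => ?_
    have ht0 : (t : ℂ) ≠ 0 := ofReal_ne_zero.2 ht.1.ne'
    rw [show B + k - 1 = (B - 1) + k by ring, cpow_add _ _ ht0, cpow_natCast, neg_pow ((r * t : ℝ) : ℂ)]
    push_cast
    rw [mul_pow]
    ring
  · intro k
    refine (hw.def'.aestronglyMeasurable).mul (Continuous.aestronglyMeasurable ?_)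
    fun_prop
  · intro k
    refine Eventually.of_forall fun t ht => ?_
    rw [Set.uIoc_of_le zero_le_one] at ht
    rw [norm_mul, norm_mul (_ * _) (_ ^ k), norm_pow, norm_neg, norm_real, Real.norm_eq_abs,
      abs_of_nonneg (mul_nonneg hr0 ht.1.le)]
    gcongr
    · exact mul_nonneg hr0 ht.1.le
    · exact mul_le_of_le_one_right hr0 ht.2
  · exact Eventually.of_forall fun t _ => (summable_norm_binomial A hr0 hr).mul_left _
  · simp_rw [tsum_mul_left]
    exact hw.norm.mul_const _
  · refine Eventually.of_forall fun t ht => ?_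
    rw [Set.uIoc_of_le zero_le_one] at ht
    refine (hasSum_binomial A ?_).mul_left _
    rw [norm_real, Real.norm_eq_abs, abs_of_nonneg (mul_nonneg hr0 ht.1.le)]
    exact (mul_le_of_le_one_right hr0 ht.2).trans_lt hr

open Complex Filter Topology MeasureTheory intervalIntegral in
/-- Euler's integral for the function `₂F₁(A, B; C; -1)`. -/
theorem regSum_eq_euler_integral {A B C : ℂ} (hB : 0 < B.re) (hC : B.re < C.re)
    (hs : -1 < (C - A - B).re) :
    regSum A B C * (Gamma B * Gamma (C - B)) =
      ∫ t in (0 : ℝ)..1, (t : ℂ) ^ (B - 1) * (1 - (t : ℂ)) ^ (C - B - 1) * (1 + (t : ℂ)) ^ (-A) := by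
  have hw : IntervalIntegrable (fun t : ℝ => (t : ℂ) ^ (B - 1) * (1 - (t : ℂ)) ^ (C - B - 1))
    volume 0 1 := betaIntegral_convergent hB (by simpa using hC)
  -- Abel's limit theorem: the binomial expansion can be integrated termwise only for r < 1, and at
  -- r = 1 the series may converge merely conditionally.
  have hlim := (tendsto_tsum_powerSeries_nhdsWithin_lt (tendsto_regSum hs)).mul_const
    (Gamma B * Gamma (C - B))
  rw [tendsto_map'_iff] at hlim
  refine tendsto_nhds_unique hlim ?_
  have hev : ∀ᶠ r : ℝ in 𝓝[<] 1, 0 < r ∧ r < 1 := Ioo_mem_nhdsLT zero_lt_one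
  refine Tendsto.congr' (f₁ := fun r : ℝ => ∫ t in (0 : ℝ)..1, (t : ℂ) ^ (B - 1) *
    (1 - (t : ℂ)) ^ (C - B - 1) * (1 + (r * t : ℝ)) ^ (-A)) ?_ ?_
  · filter_upwards [hev] with r hr
    rw [← (hasSum_euler_integral A hB hC hr.1.le hr.2).tsum_eq, tsum_mul_right]
    rfl
  -- As 1 ≤ 1 + rt ≤ 2, the last factor of the integrand is bounded uniformly in r, and the
  -- integrable beta weight dominates.
  · refine tendsto_integral_filter_of_dominated_convergence
      (fun t => ‖(t : ℂ) ^ (B - 1) * (1 - (t : ℂ)) ^ (C - B - 1)‖ *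
        ((2 : ℝ) ^ |A.re| * Real.exp (|A.im| * Real.pi))) ?_ ?_ ?_ ?_
    · filter_upwards [hev] with r hr
      refine (hw.def'.aestronglyMeasurable).mul (ContinuousOn.aestronglyMeasurable ?_
        measurableSet_uIoc)
      intro t ht
      rw [Set.uIoc_of_le zero_le_one] at ht
      refine ContinuousAt.continuousWithinAt (ContinuousAt.cpow (by fun_prop) (by fun_prop) ?_)
      left
      simp only [add_re, one_re, ofReal_re]
      have := mul_pos hr.1 ht.1
      linarith
    · filter_upwards [hev] with r hr
      refine Eventually.of_forall fun t ht => ?_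
      rw [Set.uIoc_of_le zero_le_one] at ht
      have h1 := mul_pos hr.1 ht.1
      have h2 : r * t ≤ 1 := mul_le_one₀ hr.2.le ht.1.le ht.2
      rw [norm_mul]
      gcongr
      have h3 : (1 : ℂ) + (r * t : ℝ) = ((1 + r * t : ℝ) : ℂ) := by push_cast; rfl
      rw [h3, norm_cpow_eq_rpow_re_of_pos (by linarith)]
      calc (1 + r * t) ^ (-A).re ≤ (1 + r * t) ^ |A.re| := by
            refine Real.rpow_le_rpow_of_exponent_le (by linarith) ?_
            rw [neg_re]; exact neg_le_abs _
        _ ≤ (2 : ℝ) ^ |A.re| := by gcongr; linarith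
        _ ≤ _ := le_mul_of_one_le_right (by positivity) (Real.one_le_exp (by positivity))
    · exact hw.norm.mul_const _
    · refine Eventually.of_forall fun t ht => ?_
      rw [Set.uIoc_of_le zero_le_one] at ht
      refine Tendsto.const_mul _ ?_
      have hc : ContinuousAt (fun r : ℝ => (1 + ((r * t : ℝ) : ℂ)) ^ (-A)) 1 := by
        refine ContinuousAt.cpow (by fun_prop) (by fun_prop) (Or.inl ?_)
        simp only [add_re, one_re, ofReal_re]
        linarith [ht.1]
      have := hc.tendsto.mono_left (nhdsWithin_le_nhds (s := Set.Iio 1))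
      simpa using this

/-! ### Trigonometric forms of the integral, and Kummer's theorem. -/

open Complex MeasureTheory intervalIntegral in
theorem regSum_ofReal_eq_integral {a b c : ℝ} (hb : 0 < b) (hc : b < c) (hs : -1 < c - a - b) :
    regSum a b c * (Real.Gamma b * Real.Gamma (c - b) : ℝ) =
      (∫ t in (0 : ℝ)..1, t ^ (b - 1) * (1 - t) ^ (c - b - 1) * (1 + t) ^ (-a) : ℝ) := by
  have h := regSum_eq_euler_integral (A := a) (B := b) (C := c) (by simpa) (by simpa)
    (by simpa using hs)
  rw [ofReal_mul, ← Gamma_ofReal, ← Gamma_ofReal, ofReal_sub, h, ← intervalIntegral.integral_ofReal]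
  refine integral_congr_Ioo_of_le zero_le_one fun t ht => ?_
  have h1 : 0 ≤ 1 - t := by linarith [ht.2]
  have h2 : 0 ≤ 1 + t := by linarith [ht.1]
  rw [ofReal_mul, ofReal_mul, ofReal_cpow ht.1.le, ofReal_cpow h1, ofReal_cpow h2]
  push_cast
  rfl

open Complex MeasureTheory intervalIntegral in
theorem integral_rpow_mul_one_sub_rpow {x y : ℝ} (hx : 0 < x) (hy : 0 < y) :
    ∫ t in (0 : ℝ)..1, t ^ (x - 1) * (1 - t) ^ (y - 1) =
      Real.Gamma x * Real.Gamma y / Real.Gamma (x + y) := by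
  have h := betaIntegral_eq_Gamma_mul_div (x : ℂ) y (by simpa) (by simpa)
  rw [← ofReal_add, Gamma_ofReal, Gamma_ofReal, Gamma_ofReal, betaIntegral] at h
  apply ofReal_injective
  rw [ofReal_div, ofReal_mul, ← h, ← intervalIntegral.integral_ofReal]
  refine integral_congr_Ioo_of_le zero_le_one fun t ht => ?_
  have h1 : 0 ≤ 1 - t := by linarith [ht.2]
  rw [ofReal_mul, ofReal_cpow ht.1.le, ofReal_cpow h1]
  push_cast
  rfl

open Real MeasureTheory Set in
-- The change of variables formula for an injective map of open intervals asks nothing of g, so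
-- singularities at the endpoints need no separate treatment.
theorem integral_comp_tan_sq (g : ℝ → ℝ) :
    ∫ t in (0 : ℝ)..1, g t = ∫ φ in (0 : ℝ)..(π / 4), 2 * sin φ / cos φ ^ 3 * g (tan φ ^ 2) := by
  have hπ := pi_pos
  rw [intervalIntegral.integral_of_le zero_le_one, intervalIntegral.integral_of_le (by positivity),
    integral_Ioc_eq_integral_Ioo, integral_Ioc_eq_integral_Ioo]
  have hsub : ∀ φ ∈ Ioo 0 (π / 4), φ ∈ Ioo (-(π / 2)) (π / 2) := fun φ hφ =>
    ⟨by linarith [hφ.1], by linarith [hφ.2]⟩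
  have hpos : ∀ φ ∈ Ioo 0 (π / 4), 0 < tan φ := fun φ hφ =>
    tan_pos_of_pos_of_lt_pi_div_two hφ.1 (hsub φ hφ).2
  have himg : (fun φ => tan φ ^ 2) '' Ioo 0 (π / 4) = Ioo 0 1 := by
    ext t
    constructor
    · rintro ⟨φ, hφ, rfl⟩
      have h1 := hpos φ hφ
      have h2 : tan φ < 1 := by
        rw [← tan_pi_div_four]
        exact strictMonoOn_tan (hsub φ hφ) ⟨by linarith, by linarith⟩ hφ.2
      exact ⟨by positivity, by nlinarith⟩
    · intro ht
      refine ⟨arctan (√t), ⟨?_, ?_⟩, ?_⟩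
      · rw [← arctan_zero]; exact arctan_strictMono (sqrt_pos.2 ht.1)
      · rw [← arctan_one]
        exact arctan_strictMono (by rw [sqrt_lt' one_pos]; simpa using ht.2)
      · simp only [tan_arctan]; exact sq_sqrt ht.1.le
  rw [← himg, integral_image_eq_integral_abs_deriv_smul measurableSet_Ioo
    (f' := fun φ => 2 * tan φ * (1 / cos φ ^ 2))]
  · refine setIntegral_congr_fun measurableSet_Ioo fun φ hφ => ?_
    have h1 := hpos φ hφ
    have hc : 0 < cos φ := cos_pos_of_mem_Ioo (hsub φ hφ)
    rw [abs_of_pos (by positivity), smul_eq_mul, tan_eq_sin_div_cos]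
    field_simp
  · intro φ hφ
    have h := (hasDerivAt_tan (cos_pos_of_mem_Ioo (hsub φ hφ)).ne').fun_pow 2
    simpa using h.hasDerivWithinAt
  · intro φ hφ ψ hψ h
    have h1 : tan φ = tan ψ := (pow_left_inj₀ (hpos φ hφ).le (hpos ψ hψ).le two_ne_zero).1 h
    exact strictMonoOn_tan.injOn (hsub φ hφ) (hsub ψ hψ) h1

open Real MeasureTheory Set in
theorem integral_comp_sin_sq (g : ℝ → ℝ) :
    ∫ t in (0 : ℝ)..1, g t = ∫ φ in (0 : ℝ)..(π / 2), 2 * sin φ * cos φ * g (sin φ ^ 2) := by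
  have hπ := pi_pos
  rw [intervalIntegral.integral_of_le zero_le_one, intervalIntegral.integral_of_le (by positivity),
    integral_Ioc_eq_integral_Ioo, integral_Ioc_eq_integral_Ioo]
  have hsub : ∀ φ ∈ Ioo 0 (π / 2), φ ∈ Icc (-(π / 2)) (π / 2) := fun φ hφ =>
    ⟨by linarith [hφ.1], by linarith [hφ.2]⟩
  have hpos : ∀ φ ∈ Ioo 0 (π / 2), 0 < sin φ := fun φ hφ =>
    sin_pos_of_pos_of_lt_pi hφ.1 (by linarith [hφ.2])
  have hcos : ∀ φ ∈ Ioo 0 (π / 2), 0 < cos φ := fun φ hφ =>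
    cos_pos_of_mem_Ioo ⟨by linarith [hφ.1], hφ.2⟩
  have himg : (fun φ => sin φ ^ 2) '' Ioo 0 (π / 2) = Ioo 0 1 := by
    ext t
    constructor
    · rintro ⟨φ, hφ, rfl⟩
      have h1 := hpos φ hφ
      have h2 := hcos φ hφ
      exact ⟨by positivity, by nlinarith [sin_sq_add_cos_sq φ]⟩
    · intro ht
      have h1 : √t < 1 := by rw [sqrt_lt' one_pos]; simpa using ht.2
      have h0 := sqrt_pos.2 ht.1
      refine ⟨arcsin (√t), ⟨arcsin_pos.2 h0, arcsin_lt_pi_div_two.2 h1⟩, ?_⟩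
      simp only
      rw [sin_arcsin (by linarith) h1.le, sq_sqrt ht.1.le]
  rw [← himg, integral_image_eq_integral_abs_deriv_smul measurableSet_Ioo
    (f' := fun φ => 2 * sin φ * cos φ)]
  · refine setIntegral_congr_fun measurableSet_Ioo fun φ hφ => ?_
    have h1 := hpos φ hφ
    have h2 := hcos φ hφ
    rw [abs_of_pos (by positivity), smul_eq_mul]
  · intro φ hφ
    have h := (hasDerivAt_sin φ).fun_pow 2
    simpa using h.hasDerivWithinAt
  · intro φ hφ ψ hψ h
    have h1 : sin φ = sin ψ := (pow_left_inj₀ (hpos φ hφ).le (hpos ψ hψ).le two_ne_zero).1 h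
    exact strictMonoOn_sin.injOn (hsub φ hφ) (hsub ψ hψ) h1

open Real MeasureTheory Set intervalIntegral in
theorem integral_sin_rpow_mul_cos_rpow {p q : ℝ} (hp : -1 < p) (hq : -1 < q) :
    ∫ φ in (0 : ℝ)..(π / 2), sin φ ^ p * cos φ ^ q =
      Gamma ((p + 1) / 2) * Gamma ((q + 1) / 2) / (2 * Gamma ((p + q) / 2 + 1)) := by
  have h := integral_rpow_mul_one_sub_rpow (x := (p + 1) / 2) (y := (q + 1) / 2)
    (by linarith) (by linarith)
  rw [integral_comp_sin_sq, show (p + 1) / 2 + (q + 1) / 2 = (p + q) / 2 + 1 by ring] at h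
  rw [mul_comm 2, ← div_div, ← h, eq_div_iff two_ne_zero, mul_comm, ← intervalIntegral.integral_const_mul]
  refine integral_congr_Ioo_of_le (by positivity) fun φ hφ => ?_
  have hs : 0 < sin φ := sin_pos_of_pos_of_lt_pi hφ.1 (by linarith [hφ.2, pi_pos])
  have hc : 0 < cos φ := cos_pos_of_mem_Ioo ⟨by linarith [hφ.1, pi_pos], hφ.2⟩
  rw [show 1 - sin φ ^ 2 = cos φ ^ 2 by rw [cos_sq']]
  generalize sin φ = s at hs
  generalize cos φ = c at hc
  -- Writing positive quantities as exponentials reduces the identity of real powers to a linear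
  -- identity between exponents.
  obtain ⟨x, rfl⟩ : ∃ x, s = exp x := ⟨log s, (exp_log hs).symm⟩
  obtain ⟨y, rfl⟩ : ∃ y, c = exp y := ⟨log c, (exp_log hc).symm⟩
  simp only [← exp_mul, ← exp_nat_mul]
  rw [mul_assoc, mul_assoc]
  simp only [← exp_add]
  congr 2
  push_cast
  ring

open Real MeasureTheory Set intervalIntegral in
theorem integral_euler_eq_integral_trig (a b c : ℝ) :
    ∫ t in (0 : ℝ)..1, t ^ (b - 1) * (1 - t) ^ (c - b - 1) * (1 + t) ^ (-a) =
      ∫ φ in (0 : ℝ)..(π / 4), 2 * (sin φ ^ (2 * b - 1) * cos (2 * φ) ^ (c - b - 1) *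
        cos φ ^ (2 * a - 2 * c + 1)) := by
  rw [integral_comp_tan_sq]
  refine integral_congr_Ioo_of_le (by positivity) fun φ hφ => ?_
  have hs : 0 < sin φ := sin_pos_of_pos_of_lt_pi hφ.1 (by linarith [hφ.2, pi_pos])
  have hc : 0 < cos φ := cos_pos_of_mem_Ioo ⟨by linarith [hφ.1, pi_pos], by linarith [hφ.2, pi_pos]⟩
  have hd : 0 < cos (2 * φ) := cos_pos_of_mem_Ioo
    ⟨by linarith [hφ.1, pi_pos], by linarith [hφ.2, pi_pos]⟩
  have h1 : 1 - tan φ ^ 2 = cos (2 * φ) / cos φ ^ 2 := by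
    rw [tan_eq_sin_div_cos, cos_two_mul']; field_simp
  have h2 : 1 + tan φ ^ 2 = 1 / cos φ ^ 2 := by
    rw [tan_eq_sin_div_cos]; field_simp; linarith [sin_sq_add_cos_sq φ]
  rw [h1, h2, tan_eq_sin_div_cos]
  generalize sin φ = s at hs
  generalize cos φ = c at hc
  generalize cos (2 * φ) = d at hd
  obtain ⟨x, rfl⟩ : ∃ x, s = exp x := ⟨log s, (exp_log hs).symm⟩
  obtain ⟨y, rfl⟩ : ∃ y, c = exp y := ⟨log c, (exp_log hc).symm⟩
  obtain ⟨z, rfl⟩ : ∃ z, d = exp z := ⟨log d, (exp_log hd).symm⟩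
  rw [mul_div_assoc, mul_assoc]
  simp only [← exp_mul, ← exp_nat_mul, ← exp_sub, one_div, ← exp_neg, ← exp_add]
  congr 2
  push_cast
  ring

open Real MeasureTheory Set intervalIntegral in
/-- Kummer's theorem for a range of real parameters. -/
theorem regSum_kummer {A b : ℝ} (hb : 0 < b) (hb1 : b < 1) (hA : 0 < 1 + A - 2 * b) :
    regSum A b ((1 + A - b : ℝ) : ℂ) =
      (√π * 2 ^ (-A) / (Gamma ((A + 1) / 2) * Gamma (1 + A / 2 - b)) : ℝ) := by
  have h := regSum_ofReal_eq_integral (a := A) (b := b) (c := 1 + A - b) hb (by linarith)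
    (by linarith)
  -- For c = 1 + A - b the exponents of sin φ and cos φ are both 2b - 1, so sin 2φ = 2 sin φ cos φ
  -- and the variable 2φ leave a beta integral.
  have hint : ∫ φ in (0 : ℝ)..(π / 4), 2 * (sin φ ^ (2 * b - 1) * cos (2 * φ) ^ (1 + A - b - b - 1) *
        cos φ ^ (2 * A - 2 * (1 + A - b) + 1)) = 2 ^ (1 - 2 * b) *
      ∫ φ in (0 : ℝ)..(π / 2), sin φ ^ (2 * b - 1) * cos φ ^ (A - 2 * b) := by
    have h2 := intervalIntegral.mul_integral_comp_mul_left (a := 0) (b := π / 4)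
      (f := fun φ => sin φ ^ (2 * b - 1) * cos φ ^ (A - 2 * b)) 2
    rw [show (2 : ℝ) * 0 = 0 by ring, show 2 * (π / 4) = π / 2 by ring] at h2
    rw [← h2, ← mul_assoc, ← intervalIntegral.integral_const_mul]
    refine integral_congr_Ioo_of_le (by positivity) fun φ hφ => ?_
    have hs : 0 < sin φ := sin_pos_of_pos_of_lt_pi hφ.1 (by linarith [hφ.2, pi_pos])
    have hc : 0 < cos φ := cos_pos_of_mem_Ioo
      ⟨by linarith [hφ.1, pi_pos], by linarith [hφ.2, pi_pos]⟩
    rw [sin_two_mul, mul_rpow (by positivity) hc.le, mul_rpow two_pos.le hs.le,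
      show 2 * A - 2 * (1 + A - b) + 1 = 2 * b - 1 by ring,
      show 1 + A - b - b - 1 = A - 2 * b by ring, show 2 * b - 1 = -(1 - 2 * b) by ring,
      rpow_neg two_pos.le]
    field_simp
  rw [integral_euler_eq_integral_trig, hint,
    integral_sin_rpow_mul_cos_rpow (by linarith) (by linarith),
    show (2 * b - 1 + 1) / 2 = b by ring, show 1 + A - b - b = A + 1 - 2 * b by ring,
    show (2 * b - 1 + (A - 2 * b)) / 2 + 1 = (A + 1) / 2 by ring] at h
  have hG1 : Gamma b ≠ 0 := (Gamma_pos_of_pos hb).ne'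
  have hG2 : Gamma (A + 1 - 2 * b) ≠ 0 := (Gamma_pos_of_pos (by linarith)).ne'
  have hG3 : Gamma ((A + 1) / 2) ≠ 0 := (Gamma_pos_of_pos (by linarith)).ne'
  have hG4 : Gamma (1 + A / 2 - b) ≠ 0 := (Gamma_pos_of_pos (by linarith)).ne'
  have hdup := Gamma_mul_Gamma_add_half ((A + 1) / 2 - b)
  rw [show 2 * ((A + 1) / 2 - b) = A + 1 - 2 * b by ring,
    show (A + 1) / 2 - b + 1 / 2 = 1 + A / 2 - b by ring] at hdup
  rw [← eq_div_iff (Complex.ofReal_ne_zero.2 (mul_ne_zero hG1 hG2)), ← Complex.ofReal_div] at h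
  rw [h, Complex.ofReal_inj, div_eq_div_iff (mul_ne_zero hG1 hG2) (mul_ne_zero hG3 hG4),
    show (A - 2 * b + 1) / 2 = (A + 1) / 2 - b by ring]
  have hpow : (2 : ℝ) ^ (1 - 2 * b) * 2 ^ (1 - (A + 1 - 2 * b)) = 2 * 2 ^ (-A) := by
    rw [← rpow_add two_pos, show 1 - 2 * b + (1 - (A + 1 - 2 * b)) = 1 + -A by ring,
      rpow_add two_pos, rpow_one]
  generalize Gamma ((A + 1) / 2) = G₁ at *
  generalize Gamma (1 + A / 2 - b) = G₂ at *
  generalize Gamma ((A + 1) / 2 - b) = G₃ at *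
  generalize Gamma (A + 1 - 2 * b) = G₄ at *
  generalize (2 : ℝ) ^ (1 - 2 * b) = x at *
  field_simp
  linear_combination x * hdup + G₄ * √π * hpow

/-! ### Cauchy's cosine integral. -/

/-- Cauchy's integral of `cos ^ p * cos (q *)` over a quarter period. -/
noncomputable def cosIntegral (p q : ℝ) : ℝ :=
  ∫ u in (0 : ℝ)..(Real.pi / 2), Real.cos u ^ p * Real.cos (q * u)

open Real MeasureTheory Set intervalIntegral in
theorem cosIntegral_integrable {p : ℝ} (hp : 0 < p) (q a b : ℝ) :
    IntervalIntegrable (fun u => cos u ^ p * cos (q * u)) volume a b := by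
  apply Continuous.intervalIntegrable
  exact (continuous_cos.rpow_const fun _ => Or.inr hp.le).mul (by fun_prop)

open Real MeasureTheory Set intervalIntegral in
-- Integrate the derivative of f'g - fg' with f = cos^(p+2) and g = cos(q·). The boundary terms
-- vanish, at 0 through the sines and at π/2 through the powers of the cosine.
theorem cosIntegral_add_two {p : ℝ} (hp : 0 < p) (q : ℝ) :
    ((p + 2) ^ 2 - q ^ 2) * cosIntegral (p + 2) q = (p + 2) * (p + 1) * cosIntegral p q := by
  have hd0 : ∀ r : ℝ, 1 ≤ r → ∀ u, HasDerivAt (fun u => cos u ^ r) (-sin u * r * cos u ^ (r - 1)) u :=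
    fun r hr u => (hasDerivAt_cos u).rpow_const (Or.inr hr)
  have hd : ∀ u : ℝ, HasDerivAt (fun u => -sin u * (p + 2) * cos u ^ (p + 1) * cos (q * u) +
      q * cos u ^ (p + 2) * sin (q * u))
      (((-cos u * (p + 2)) * cos u ^ (p + 1) + -sin u * (p + 2) *
        (-sin u * (p + 1) * cos u ^ p)) * cos (q * u) + q ^ 2 * cos u ^ (p + 2) * cos (q * u)) u := by
    intro u
    have h1 := hd0 (p + 1) (by linarith) u
    have h2 := hd0 (p + 2) (by linarith) u
    rw [show p + 1 - 1 = p by ring] at h1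
    rw [show p + 2 - 1 = p + 1 by ring] at h2
    have h3 : HasDerivAt (fun u => cos (q * u)) (-sin (q * u) * q) u := by
      simpa using ((hasDerivAt_id u).const_mul q).cos
    have h4 : HasDerivAt (fun u => sin (q * u)) (cos (q * u) * q) u := by
      simpa using ((hasDerivAt_id u).const_mul q).sin
    have h5 := (((((hasDerivAt_sin u).neg.mul_const (p + 2)).mul h1).mul h3).add
      ((h2.const_mul q).mul h4))
    refine h5.congr_deriv ?_
    simp only [Pi.neg_apply, Pi.mul_apply]
    ring
  have hcont : ∀ r : ℝ, 0 < r → Continuous fun u => cos u ^ r :=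
    fun r hr => continuous_cos.rpow_const fun _ => Or.inr hr.le
  have h0 := hcont p hp
  have h1 := hcont (p + 1) (by linarith)
  have h2 := hcont (p + 2) (by linarith)
  have hint := integral_eq_sub_of_hasDerivAt (a := 0) (b := π / 2) (fun u _ => hd u)
    (Continuous.intervalIntegrable (by fun_prop) _ _)
  rw [cos_pi_div_two, zero_rpow (by linarith), zero_rpow (by linarith), sin_zero, mul_zero q,
    sin_zero] at hint
  have hcongr : ∫ u in (0 : ℝ)..(π / 2), (((-cos u * (p + 2)) * cos u ^ (p + 1) + -sin u * (p + 2) *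
        (-sin u * (p + 1) * cos u ^ p)) * cos (q * u) + q ^ 2 * cos u ^ (p + 2) * cos (q * u)) =
      ∫ u in (0 : ℝ)..(π / 2), ((p + 2) * (p + 1) * (cos u ^ p * cos (q * u)) -
        ((p + 2) ^ 2 - q ^ 2) * (cos u ^ (p + 2) * cos (q * u))) := by
    refine integral_congr_Ioo_of_le (by positivity) fun u hu => ?_
    have hc : 0 < cos u := cos_pos_of_mem_Ioo ⟨by linarith [hu.1, pi_pos], hu.2⟩
    have e1 : cos u ^ (p + 1) = cos u ^ p * cos u := rpow_add_one hc.ne' p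
    have e2 : cos u ^ (p + 2) = cos u ^ p * cos u * cos u := by
      rw [← e1, ← rpow_add_one hc.ne', show p + 1 + 1 = p + 2 by ring]
    rw [e1, e2]
    linear_combination (p + 2) * (p + 1) * cos u ^ p * cos (q * u) * sin_sq_add_cos_sq u
  rw [hcongr, intervalIntegral.integral_sub ((cosIntegral_integrable hp q _ _).const_mul _)
    ((cosIntegral_integrable (by linarith) q _ _).const_mul _),
    intervalIntegral.integral_const_mul, intervalIntegral.integral_const_mul] at hint
  simp only [cosIntegral]
  linarith

open Real MeasureTheory Set intervalIntegral in
theorem cosIntegral_zero_right {p : ℝ} (hp : 0 < p) :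
    cosIntegral p 0 = √π * Gamma ((p + 1) / 2) / (2 * Gamma (1 + p / 2)) := by
  have h := integral_sin_rpow_mul_cos_rpow (p := 0) (q := p) (by linarith) (by linarith)
  simp only [cosIntegral, zero_mul, cos_zero, mul_one]
  simp only [rpow_zero, one_mul, zero_add, Gamma_one_half_eq] at h
  rw [h, add_comm (p / 2)]

open Real MeasureTheory Set intervalIntegral in
-- Jordan's inequality gives 1 - cos(qu) ≤ q²u²/2 ≤ q²(π²/8) sin² u, and the integral of cos^p ·
-- sin² is the integral of cos^p divided by p + 2, by the recurrence at q = 0. Hence the influence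
-- of q disappears as p grows.
theorem cosIntegral_bounds {p : ℝ} (hp : 0 < p) (q : ℝ) :
    cosIntegral p q ≤ cosIntegral p 0 ∧
      cosIntegral p 0 * (1 - q ^ 2 * (π ^ 2 / 8) / (p + 2)) ≤ cosIntegral p q := by
  have hpi := pi_pos
  have hcos : ∀ u ∈ Icc 0 (π / 2), 0 ≤ cos u := fun u hu =>
    cos_nonneg_of_mem_Icc ⟨by linarith [hu.1], hu.2⟩
  constructor
  · refine integral_mono_on (by positivity) (cosIntegral_integrable hp _ _ _)
      (cosIntegral_integrable hp _ _ _) fun u hu => ?_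
    have := rpow_nonneg (hcos u hu) p
    rw [zero_mul, cos_zero]
    gcongr
    exact cos_le_one _
  · have hrec := cosIntegral_add_two hp 0
    have h1 : cosIntegral p 0 * (1 - q ^ 2 * (π ^ 2 / 8) / (p + 2)) =
        cosIntegral p 0 - q ^ 2 * (π ^ 2 / 8) * (cosIntegral p 0 - cosIntegral (p + 2) 0) := by
      have h2 : (p + 2) * cosIntegral (p + 2) 0 = (p + 1) * cosIntegral p 0 := by
        refine mul_left_cancel₀ (show p + 2 ≠ 0 by linarith) ?_
        linarith
      field_simp
      linear_combination (-8 * q ^ 2 * π ^ 2 / 8) * h2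
    have i1 := cosIntegral_integrable hp 0 0 (π / 2)
    have i2 := cosIntegral_integrable (p := p + 2) (by linarith) 0 0 (π / 2)
    rw [h1]
    simp only [cosIntegral]
    rw [← intervalIntegral.integral_sub i1 i2, ← intervalIntegral.integral_const_mul,
      ← intervalIntegral.integral_sub i1 ((i1.sub i2).const_mul _)]
    refine integral_mono_on (by positivity) (i1.sub ((i1.sub i2).const_mul _))
      (cosIntegral_integrable hp _ _ _) fun u hu => ?_
    have hc := hcos u hu
    have hs : 2 / π * u ≤ sin u := mul_le_sin hu.1 hu.2
    have hs2 : u ^ 2 ≤ π ^ 2 / 4 * sin u ^ 2 := by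
      have h3 : u ≤ π / 2 * sin u := by
        calc u = π / 2 * (2 / π * u) := by field_simp
          _ ≤ _ := by gcongr
      calc u ^ 2 ≤ (π / 2 * sin u) ^ 2 := by have := hu.1; gcongr
        _ = _ := by ring
    have h4 := one_sub_sq_div_two_le_cos (x := q * u)
    have h5 : cos u ^ (p + 2) = cos u ^ p * cos u ^ 2 := by
      rw [rpow_add' hc (by linarith), rpow_two]
    have h6 := rpow_nonneg hc p
    simp only [zero_mul, cos_zero, mul_one]
    rw [h5]
    have h7 : 1 - q ^ 2 * (π ^ 2 / 8) * sin u ^ 2 ≤ cos (q * u) := by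
      have := mul_le_mul_of_nonneg_left hs2 (sq_nonneg q)
      nlinarith
    calc _ = cos u ^ p * (1 - q ^ 2 * (π ^ 2 / 8) * sin u ^ 2) := by rw [sin_sq]; ring
      _ ≤ _ := by gcongr

open Real Filter Topology in
/-- Cauchy's cosine integral. -/
theorem cosIntegral_eq {p q : ℝ} (hp : 0 < p) (hq : |q| < 1) :
    cosIntegral p q = √π * Gamma ((p + 1) / 2) * Gamma (1 + p / 2) /
      (2 * (Gamma (1 + (p + q) / 2) * Gamma (1 + (p - q) / 2))) := by
  have hq' := abs_lt.1 hq
  have hJ : ∀ r : ℝ, 0 < r → 0 < cosIntegral r 0 := fun r hr => by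
    rw [cosIntegral_zero_right hr]
    have := Gamma_pos_of_pos (show 0 < (r + 1) / 2 by linarith)
    have := Gamma_pos_of_pos (show 0 < 1 + r / 2 by linarith)
    positivity
  have hn : ∀ n : ℕ, 0 < p + 2 * n := fun n => by positivity
  -- The recurrence is iterated on the ratio to the case q = 0. This ratio tends to 1, so its
  -- initial value is the reciprocal of an infinite product.
  have hprod : ∀ n : ℕ, cosIntegral (p + 2 * n) q / cosIntegral (p + 2 * n) 0 =
      cosIntegral p q / cosIntegral p 0 * ∏ j ∈ Finset.range n,
        ((1 + p / 2 + j) ^ 2 / ((1 + (p + q) / 2 + j) * (1 + (p - q) / 2 + j))) := by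
    intro n
    induction n with
    | zero => simp
    | succ n ih =>
      have h1 := cosIntegral_add_two (hn n) q
      have h2 := cosIntegral_add_two (hn n) 0
      have h3 := (hJ _ (hn n)).ne'
      have h4 := (hJ _ (hn (n + 1))).ne'
      rw [Finset.prod_range_succ, ← mul_assoc, ← ih]
      have hn0 : (0 : ℝ) ≤ n := n.cast_nonneg
      have h5 : 1 + (p + q) / 2 + (n : ℝ) ≠ 0 := by linarith
      have h6 : 1 + (p - q) / 2 + (n : ℝ) ≠ 0 := by linarith
      rw [div_mul_div_comm, div_eq_div_iff h4 (mul_ne_zero h3 (mul_ne_zero h5 h6))]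
      push_cast at h4 ⊢
      rw [show p + 2 * (n + 1 : ℝ) = p + 2 * n + 2 by ring] at h4 ⊢
      have h7 : p + 2 * n + 1 ≠ 0 := by linarith
      have h8 : p + 2 * n + 2 ≠ 0 := by linarith
      refine mul_left_cancel₀ (mul_ne_zero h8 h7) ?_
      linear_combination ((p + 2 * n + 2) * (p + 2 * n + 1) / 4 * cosIntegral (p + 2 * n) 0) * h1 -
        ((p + 2 * n + 2) * (p + 2 * n + 1) / 4 * cosIntegral (p + 2 * n) q) * h2
  have hlim1 : Tendsto (fun n : ℕ => cosIntegral (p + 2 * n) q / cosIntegral (p + 2 * n) 0) atTop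
      (𝓝 1) := by
    have hl : Tendsto (fun n : ℕ => 1 - q ^ 2 * (π ^ 2 / 8) / (p + 2 * n + 2)) atTop (𝓝 1) := by
      have : Tendsto (fun n : ℕ => p + 2 * (n : ℝ) + 2) atTop atTop :=
        tendsto_atTop_add_const_right _ _ (tendsto_atTop_add_const_left _ _
          (tendsto_natCast_atTop_atTop.const_mul_atTop two_pos))
      simpa using (this.const_div_atTop (q ^ 2 * (π ^ 2 / 8))).const_sub 1
    refine tendsto_of_tendsto_of_tendsto_of_le_of_le hl tendsto_const_nhds (fun n => ?_) fun n => ?_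
    · have := (cosIntegral_bounds (hn n) q).2
      rw [le_div_iff₀ (hJ _ (hn n)), mul_comm]
      exact this
    · rw [div_le_one (hJ _ (hn n))]
      exact (cosIntegral_bounds (hn n) q).1
  have hG1 := Gamma_pos_of_pos (show 0 < 1 + p / 2 by linarith)
  have hG2 := Gamma_pos_of_pos (show 0 < 1 + (p + q) / 2 by linarith)
  have hG3 := Gamma_pos_of_pos (show 0 < 1 + (p - q) / 2 by linarith)
  -- The product over `range (n + 1)` matches the one in `GammaSeq`. The powers of n and the
  -- factorials cancel because 1 + (p + q)/2 and 1 + (p - q)/2 add up to 2(1 + p/2).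
  have hlim2 : Tendsto (fun n : ℕ => ∏ j ∈ Finset.range (n + 1),
        ((1 + p / 2 + j) ^ 2 / ((1 + (p + q) / 2 + j) * (1 + (p - q) / 2 + j)))) atTop
      (𝓝 (Gamma (1 + (p + q) / 2) * Gamma (1 + (p - q) / 2) / Gamma (1 + p / 2) ^ 2)) := by
    have h1 := (GammaSeq_tendsto_Gamma (1 + (p + q) / 2)).mul
      (GammaSeq_tendsto_Gamma (1 + (p - q) / 2))
    have h2 := h1.div ((GammaSeq_tendsto_Gamma (1 + p / 2)).pow 2) (by positivity)
    refine h2.congr' ?_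
    filter_upwards [eventually_gt_atTop 0] with n hn
    have hn0 : (0 : ℝ) < n := by exact_mod_cast hn
    simp only [Pi.div_apply, GammaSeq, Finset.prod_div_distrib, Finset.prod_mul_distrib,
      Finset.prod_pow]
    have hp1 : ∀ x : ℝ, 0 < x → ∏ j ∈ Finset.range (n + 1), (x + j) ≠ 0 := fun x hx =>
      Finset.prod_ne_zero_iff.2 fun j _ => by positivity
    have e1 := hp1 (1 + p / 2) (by linarith)
    have e2 := hp1 (1 + (p + q) / 2) (by linarith)
    have e3 := hp1 (1 + (p - q) / 2) (by linarith)
    have e4 : (n.factorial : ℝ) ≠ 0 := by positivity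
    have e5 : (n : ℝ) ^ (1 + (p + q) / 2) * (n : ℝ) ^ (1 + (p - q) / 2) =
        ((n : ℝ) ^ (1 + p / 2)) ^ 2 := by
      rw [← rpow_add hn0, ← rpow_natCast, ← rpow_mul hn0.le]
      congr 1; push_cast; ring
    have e6 := (rpow_pos_of_pos hn0 (1 + p / 2)).ne'
    generalize ∏ j ∈ Finset.range (n + 1), (1 + p / 2 + (j : ℝ)) = X at *
    generalize ∏ j ∈ Finset.range (n + 1), (1 + (p + q) / 2 + (j : ℝ)) = Y at *
    generalize ∏ j ∈ Finset.range (n + 1), (1 + (p - q) / 2 + (j : ℝ)) = Z at *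
    generalize (n : ℝ) ^ (1 + p / 2) = x at *
    generalize (n : ℝ) ^ (1 + (p + q) / 2) = y at *
    generalize (n : ℝ) ^ (1 + (p - q) / 2) = z at *
    field_simp
    linear_combination e5
  have hfin := tendsto_nhds_unique (((tendsto_add_atTop_iff_nat 1).2 hlim1).congr
    fun n => hprod (n + 1)) (hlim2.const_mul _)
  have h0 := (hJ p hp).ne'
  have h1 := cosIntegral_zero_right hp
  have hG4 := Gamma_pos_of_pos (show 0 < (p + 1) / 2 by linarith)
  have hsq := sqrt_pos.2 pi_pos
  rw [h1] at hfin
  generalize Gamma ((p + 1) / 2) = G₁ at *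
  generalize Gamma (1 + p / 2) = G₂ at *
  generalize Gamma (1 + (p + q) / 2) = G₃ at *
  generalize Gamma (1 + (p - q) / 2) = G₄ at *
  field_simp at hfin ⊢
  linarith

/-! ### Telescoping relations between contiguous series. -/

theorem regCoeff_add_one_upper (A B C : ℂ) (k : ℕ) :
    regCoeff A (B + 1) C k * B = regCoeff A B C k * (B + k) := by
  have h : (ascPochhammer ℂ k).eval (B + 1) * B = (ascPochhammer ℂ k).eval B * (B + k) := by
    induction k with
    | zero => simp
    | succ n ih =>
      rw [ascPochhammer_succ_eval, ascPochhammer_succ_eval]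
      push_cast
      linear_combination (B + 1 + n) * ih
  simp only [regCoeff]
  linear_combination ((ascPochhammer ℂ k).eval A * ((k.factorial : ℂ)⁻¹ *
    (Complex.Gamma (C + k))⁻¹)) * h

theorem regCoeff_add_one_lower (A B C : ℂ) (k : ℕ) :
    regCoeff A B C k = regCoeff A B (C + 1) k * (C + k) := by
  simp only [regCoeff]
  rw [Complex.one_div_Gamma_eq_self_mul_one_div_Gamma_add_one (C + k),
    show C + k + 1 = C + 1 + k by ring]
  ring

open Filter Topology in
-- With the signs (-1)^k included, g (k + 1) + g k telescopes, and the two boundary terms vanish by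
-- `hg0` and `hg`.
theorem regSum_eq_mul_of_telescoping {A B C A' B' C' : ℂ} (h : -1 < (C - A - B).re)
    (h' : -1 < (C' - A' - B').re) {R : ℂ} {g : ℕ → ℂ} (hg0 : g 0 = 0)
    (hg : Tendsto g atTop (𝓝 0))
    (hk : ∀ k, regCoeff A B C k = R * regCoeff A' B' C' k + (g (k + 1) + g k)) :
    regSum A B C = R * regSum A' B' C' := by
  refine tendsto_nhds_unique (tendsto_regSum h) ?_
  have h1 : ∀ N, ∑ k ∈ Finset.range N, regCoeff A B C k * (-1) ^ k =
      R * ∑ k ∈ Finset.range N, regCoeff A' B' C' k * (-1) ^ k - g N * (-1) ^ N := by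
    intro N
    induction N with
    | zero => simp [hg0]
    | succ n ih => rw [Finset.sum_range_succ, Finset.sum_range_succ, ih, hk, pow_succ]; ring
  rw [funext h1]
  have h2 : Tendsto (fun N => g N * (-1) ^ N) atTop (𝓝 0) := by
    rw [tendsto_zero_iff_norm_tendsto_zero] at hg ⊢
    simpa using hg
  simpa using ((tendsto_regSum h').const_mul R).sub h2

open Filter Topology in
theorem tendsto_add_natCast_div_add_natCast (x y : ℂ) :
    Tendsto (fun k : ℕ => (x + k) / (y + k)) atTop (𝓝 1) := by
  have h := (tendsto_natCast_div_add_atTop y).div (tendsto_natCast_div_add_atTop x) one_ne_zero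
  rw [div_one] at h
  refine h.congr' ?_
  filter_upwards [eventually_gt_atTop 0] with k hk
  have hk' : (k : ℂ) ≠ 0 := by exact_mod_cast hk.ne'
  simp only [Pi.div_apply]
  rw [div_div_div_cancel_left' _ _ hk', add_comm x, add_comm y]

open Filter Topology in
-- The series on the right is Kummer's, since 1 + (a - 4) - (2a/3 - 3) = a/3. The hypothesis `h`
-- keeps the denominators of the certificate away from zero.
theorem regSum_contiguous_sub_four {a : ℂ} (hs : -1 < (6 - 4 / 3 * a).re)
    (h : ∀ n : ℕ, 2 / 3 * a - 3 + n ≠ 0) (hc : ∀ n : ℕ, 1 + 1 / 3 * a + n ≠ 0) :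
    regSum (a - 4) (2 / 3 * a - 1) (1 + 1 / 3 * a) =
      3 / (4 * (a - 3)) * regSum (a - 4) (2 / 3 * a - 3) (1 / 3 * a) := by
  have hs1 : (1 + 1 / 3 * a - (a - 4) - (2 / 3 * a - 1)) = 6 - 4 / 3 * a := by ring
  have hs2 : (1 / 3 * a - (a - 4) - (2 / 3 * a - 3)) = 6 - 4 / 3 * a + 1 := by ring
  have h1 : ∀ n : ℕ, 2 / 3 * a - 2 + n ≠ 0 := fun n => by
    have := h (n + 1); push_cast at this; convert this using 1; ring
  have h3 : a - 3 ≠ 0 := fun h0 => h1 0 (by push_cast; linear_combination 2 / 3 * h0)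
  have hβ0 := h 0
  rw [Nat.cast_zero, add_zero] at hβ0
  have hv : ∀ k : ℕ, regCoeff (a - 4) (2 / 3 * a - 3) (1 / 3 * a) k =
      regCoeff (a - 4) (2 / 3 * a - 1) (1 + 1 / 3 * a) k *
      ((2 / 3 * a - 3) * (2 / 3 * a - 2) * (1 / 3 * a + k) /
        ((2 / 3 * a - 3 + k) * (2 / 3 * a - 2 + k))) := by
    intro k
    have e1 := regCoeff_add_one_upper (a - 4) (2 / 3 * a - 3) (1 / 3 * a) k
    have e2 := regCoeff_add_one_upper (a - 4) (2 / 3 * a - 2) (1 / 3 * a) k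
    have e3 := regCoeff_add_one_lower (a - 4) (2 / 3 * a - 1) (1 / 3 * a) k
    rw [show 2 / 3 * a - 3 + 1 = 2 / 3 * a - 2 by ring] at e1
    rw [show 2 / 3 * a - 2 + 1 = 2 / 3 * a - 1 by ring] at e2
    rw [add_comm (1 / 3 * a) 1] at e3
    rw [← mul_div_assoc, eq_div_iff (mul_ne_zero (h k) (h1 k))]
    linear_combination (-(2 / 3 * a - 2 + k)) * e1 - (2 / 3 * a - 3) * e2 +
      (2 / 3 * a - 3) * (2 / 3 * a - 2) * e3
  -- The certificate g is the coefficient times a rational function of k with limit 1/2, so it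
  -- decays with the coefficients; its factor k gives g 0 = 0. The second series has excess larger
  -- by 1, hence converges too.
  refine regSum_eq_mul_of_telescoping (by rwa [hs1])
    (by rw [hs2, Complex.add_re, Complex.one_re]; linarith)
    (g := fun k => regCoeff (a - 4) (2 / 3 * a - 1) (1 + 1 / 3 * a) k *
      (k * (1 / 3 * a + k) / (2 * (2 / 3 * a - 3 + k) * (2 / 3 * a - 2 + k)))) (by simp) ?_ ?_
  · have l1 := tendsto_regCoeff_zero (A := a - 4) (B := 2 / 3 * a - 1) (C := 1 + 1 / 3 * a)
      (by rwa [hs1])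
    have l2 := (tendsto_add_natCast_div_add_natCast 0 (2 / 3 * a - 3)).mul
      (tendsto_add_natCast_div_add_natCast (1 / 3 * a) (2 / 3 * a - 2))
    have l3 := l1.mul (l2.const_mul (1 / 2))
    rw [zero_mul] at l3
    refine l3.congr fun k => ?_
    rw [zero_add, div_mul_div_comm, div_mul_div_comm, one_mul, ← mul_assoc]
  · intro k
    have hk1 : (k : ℂ) + 1 ≠ 0 := by exact_mod_cast k.succ_ne_zero
    have hc1 : 1 + 1 / 3 * a + k ≠ 0 := hc k
    have e := regCoeff_succ_mul (a - 4) (2 / 3 * a - 1) (1 + 1 / 3 * a) k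
    rw [← eq_div_iff (mul_ne_zero hc1 hk1)] at e
    have h0 := h k
    have h2 := h1 k
    have h4 := h1 (k + 1)
    rw [hv k, e]
    push_cast at h4 ⊢
    generalize regCoeff (a - 4) (2 / 3 * a - 1) (1 + 1 / 3 * a) k = t
    rw [show 2 / 3 * a - 3 + (k + 1 : ℂ) = 2 / 3 * a - 2 + k by ring,
      show 1 / 3 * a + (k + 1 : ℂ) = 1 + 1 / 3 * a + k by ring]
    obtain ⟨γ, rfl⟩ : ∃ γ, a = 3 * γ := ⟨a / 3, by ring⟩
    rw [show 1 / 3 * (3 * γ) = γ by ring] at *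
    rw [show 2 / 3 * (3 * γ) = 2 * γ by ring] at *
    have h5 : 2 * γ - 1 + k ≠ 0 := by convert h4 using 1; ring
    rw [show 2 * γ - 2 + (k + 1 : ℂ) = 2 * γ - 1 + k by ring]
    have h6 : γ - 1 ≠ 0 := fun h0 => h3 (by linear_combination 3 * h0)
    have e6 : 3 * γ - 3 = 3 * (γ - 1) := by ring
    have e7 : 2 * γ - 2 = 2 * (γ - 1) := by ring
    clear hv e h hc h1 hs hs1 hs2 h4
    -- The three denominators are X, X + 1 and X + 2, which leaves a polynomial identity.
    obtain ⟨X, hX⟩ : ∃ X, X = 2 * γ - 3 + (k : ℂ) := ⟨_, rfl⟩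
    have hX1 : 2 * γ - 2 + (k : ℂ) = X + 1 := by rw [hX]; ring
    have hX2 : 2 * γ - 1 + (k : ℂ) = X + 2 := by rw [hX]; ring
    rw [hX1] at h2
    rw [hX2] at h5
    rw [← hX] at h0
    rw [hX1, hX2, ← hX, e6, e7]
    clear hX1 hX2
    generalize (k : ℂ) = κ at *
    field_simp
    rw [show κ = X + 3 - 2 * γ by rw [hX]; ring]
    ring

open Filter Topology in
-- Again the right-hand series is Kummer's, since 1 + (a + 2) - (2a/3 + 1) = a/3 + 2; the
-- certificate is the coefficient times k / (2(a/3 + k)).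
theorem regSum_contiguous_add_two {a : ℂ} (hs : -1 < (-2 - 4 / 3 * a).re)
    (h : ∀ n : ℕ, 1 / 3 * a + n ≠ 0) :
    regSum (a + 2) (2 / 3 * a) (1 / 3 * a) =
      -((2 * a + 3) * a / 9) * regSum (a + 2) (2 / 3 * a + 1) (1 / 3 * a + 2) := by
  have hs1 : (1 / 3 * a - (a + 2) - (2 / 3 * a)) = -2 - 4 / 3 * a := by ring
  have hs2 : (1 / 3 * a + 2 - (a + 2) - (2 / 3 * a + 1)) = -2 - 4 / 3 * a + 1 := by ring
  have h1 : ∀ n : ℕ, 1 / 3 * a + 1 + n ≠ 0 := fun n => by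
    have := h (n + 1); push_cast at this; convert this using 1; ring
  have hb0 : a ≠ 0 := fun h0 => h 0 (by simp [h0])
  have hv : ∀ k : ℕ, regCoeff (a + 2) (2 / 3 * a + 1) (1 / 3 * a + 2) k =
      regCoeff (a + 2) (2 / 3 * a) (1 / 3 * a) k *
      ((2 / 3 * a + k) / (2 / 3 * a * ((1 / 3 * a + k) * (1 / 3 * a + 1 + k)))) := by
    intro k
    have e1 := regCoeff_add_one_upper (a + 2) (2 / 3 * a) (1 / 3 * a + 2) k
    have e2 := regCoeff_add_one_lower (a + 2) (2 / 3 * a) (1 / 3 * a) k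
    have e3 := regCoeff_add_one_lower (a + 2) (2 / 3 * a) (1 / 3 * a + 1) k
    rw [show 1 / 3 * a + 1 + 1 = 1 / 3 * a + 2 by ring] at e3
    rw [← mul_div_assoc, eq_div_iff (mul_ne_zero (mul_ne_zero (by norm_num) hb0)
      (mul_ne_zero (h k) (h1 k)))]
    linear_combination (1 / 3 * a + k) * (1 / 3 * a + 1 + k) * e1 - (2 / 3 * a + k) * e2 -
      (2 / 3 * a + k) * (1 / 3 * a + k) * e3
  refine regSum_eq_mul_of_telescoping (by rwa [hs1])
    (by rw [hs2, Complex.add_re, Complex.one_re]; linarith)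
    (g := fun k => regCoeff (a + 2) (2 / 3 * a) (1 / 3 * a) k *
      (k / (2 * (1 / 3 * a + k)))) (by simp) ?_ ?_
  · have l1 := tendsto_regCoeff_zero (A := a + 2) (B := 2 / 3 * a) (C := 1 / 3 * a)
      (by rwa [hs1])
    have l2 := (tendsto_add_natCast_div_add_natCast 0 (1 / 3 * a))
    have l3 := l1.mul (l2.const_mul (1 / 2))
    rw [zero_mul] at l3
    refine l3.congr fun k => ?_
    rw [zero_add, div_mul_div_comm, one_mul]
  · intro k
    have hk1 : (k : ℂ) + 1 ≠ 0 := by exact_mod_cast k.succ_ne_zero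
    have e := regCoeff_succ_mul (a + 2) (2 / 3 * a) (1 / 3 * a) k
    rw [← eq_div_iff (mul_ne_zero (h k) hk1)] at e
    have h0 := h k
    have h2 := h1 k
    rw [hv k, e]
    push_cast
    generalize regCoeff (a + 2) (2 / 3 * a) (1 / 3 * a) k = t
    rw [show 1 / 3 * a + (k + 1 : ℂ) = 1 / 3 * a + 1 + k by ring]
    obtain ⟨γ, rfl⟩ : ∃ γ, a = 3 * γ := ⟨a / 3, by ring⟩
    rw [show 1 / 3 * (3 * γ) = γ by ring] at *
    rw [show 2 / 3 * (3 * γ) = 2 * γ by ring]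
    have hγ : γ ≠ 0 := fun h0 => hb0 (by rw [h0, mul_zero])
    field_simp
    ring

/-! ### Analytic continuation, and the four sums in entire form. -/

open Filter Topology in
-- The excess is affine with real coefficients, so the domain of convergence is convex, hence
-- connected, and the identity theorem applies. R is required to be entire, so no exceptional
-- parameters arise.
theorem regSum_eq_of_eq_on_interval {A B C R : ℂ → ℂ} (hA : Differentiable ℂ A)
    (hB : Differentiable ℂ B) (hC : Differentiable ℂ C) (hR : Differentiable ℂ R) {e₀ e₁ l u : ℝ}
    (hlu : l < u) (he : ∀ z, C z - A z - B z = e₀ + e₁ * z)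
    (hdom : ∀ x ∈ Set.Ioo l u, -1 < e₀ + e₁ * x)
    (heq : ∀ x ∈ Set.Ioo l u, regSum (A (x : ℝ)) (B (x : ℝ)) (C (x : ℝ)) = R (x : ℝ)) {z : ℂ}
    (hz : -1 < (C z - A z - B z).re) : regSum (A z) (B z) (C z) = R z := by
  have hre : ∀ z, (C z - A z - B z).re = e₀ + e₁ * z.re := fun z => by simp [he]
  have hconv : Convex ℝ {z : ℂ | -1 < (C z - A z - B z).re} := by
    have hset : {z : ℂ | -1 < (C z - A z - B z).re} = {z : ℂ | -1 - e₀ < e₁ * z.re} := by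
      ext z
      simp only [Set.mem_ofPred_eq, hre]
      constructor <;> intro h <;> linarith
    rw [hset]
    refine convex_halfSpace_gt ⟨fun x y => ?_, fun c x => ?_⟩ _
    · rw [Complex.add_re]; ring
    · rw [Complex.real_smul, Complex.re_ofReal_mul, smul_eq_mul]; ring
  have hopen : IsOpen {z : ℂ | -1 < (C z - A z - B z).re} := by
    have := hA.continuous
    have := hB.continuous
    have := hC.continuous
    exact isOpen_lt (by fun_prop) (by fun_prop)
  obtain ⟨m, hm⟩ := Set.nonempty_Ioo.2 hlu
  refine AnalyticOnNhd.eqOn_of_preconnected_of_frequently_eq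
    ((differentiableOn_regSum hA hB hC).analyticOnNhd hopen)
    (hR.differentiableOn.analyticOnNhd hopen) hconv.isPreconnected (z₀ := (m : ℂ)) ?_ ?_ hz
  · simp only [Set.mem_ofPred_eq, hre, Complex.ofReal_re]
    exact hdom m hm
  · have ht : Tendsto (fun x : ℝ => (x : ℂ)) (𝓝[≠] m) (𝓝[≠] (m : ℂ)) := by
      refine tendsto_nhdsWithin_of_tendsto_nhds_of_eventually_within _
        (Complex.continuous_ofReal.continuousAt.tendsto.mono_left nhdsWithin_le_nhds) ?_
      filter_upwards [self_mem_nhdsWithin] with x hx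
      exact fun h => hx (Complex.ofReal_injective h)
    refine ht.frequently (Eventually.frequently ?_)
    filter_upwards [nhdsWithin_le_nhds (Ioo_mem_nhds hm.1 hm.2)] with x hx
    exact heq x hx

theorem differentiable_inv_Gamma_comp {f : ℂ → ℂ} (hf : Differentiable ℂ f) :
    Differentiable ℂ fun z => (Complex.Gamma (f z))⁻¹ :=
  Complex.differentiable_one_div_Gamma.comp hf

theorem differentiable_two_cpow {f : ℂ → ℂ} (hf : Differentiable ℂ f) :
    Differentiable ℂ fun z => (2 : ℂ) ^ f z :=
  fun z => (hf z).const_cpow (Or.inl two_ne_zero)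

open Real MeasureTheory intervalIntegral in
-- With φ = π/8 - u/4, sin 4φ becomes cos u. Folding u with -u removes the odd part of cos(φ - θ)
-- and leaves 2 cos(π/8 - θ) times Cauchy's integral with q = 1/4.
theorem integral_sin_four_mul_rpow {p : ℝ} (hp : 0 < p) (θ : ℝ) :
    ∫ φ in (0 : ℝ)..(π / 4), sin (4 * φ) ^ p * cos (φ - θ) =
      cos (π / 8 - θ) * (π * 2 ^ (-p - 2) * Gamma (p + 1) /
        (Gamma (9 / 8 + p / 2) * Gamma (7 / 8 + p / 2))) := by
  have h1 := intervalIntegral.integral_comp_sub_div (a := -(π / 2)) (b := π / 2)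
    (fun φ => sin (4 * φ) ^ p * cos (φ - θ)) (c := 4) four_ne_zero (π / 8)
  rw [show π / 8 - π / 2 / 4 = 0 by ring, show π / 8 - -(π / 2) / 4 = π / 4 by ring,
    smul_eq_mul] at h1
  have hcont : Continuous fun u => sin (4 * (π / 8 - u / 4)) ^ p * cos (π / 8 - u / 4 - θ) :=
    (Continuous.rpow_const (by fun_prop) fun _ => Or.inr hp.le).mul (by fun_prop)
  have h2 := integral_add_adjacent_intervals (hcont.intervalIntegrable (-(π / 2)) 0)
    (hcont.intervalIntegrable (μ := volume) 0 (π / 2))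
  have h3 := intervalIntegral.integral_comp_neg (a := 0) (b := π / 2)
    (fun u => sin (4 * (π / 8 - u / 4)) ^ p * cos (π / 8 - u / 4 - θ))
  rw [neg_zero] at h3
  have hcont' : Continuous fun u => sin (4 * (π / 8 - -u / 4)) ^ p * cos (π / 8 - -u / 4 - θ) :=
    (Continuous.rpow_const (by fun_prop) fun _ => Or.inr hp.le).mul (by fun_prop)
  rw [← h3, ← intervalIntegral.integral_add (hcont'.intervalIntegrable _ _)
    (hcont.intervalIntegrable _ _)] at h2
  have h4 : ∫ u in (0 : ℝ)..(π / 2), (sin (4 * (π / 8 - -u / 4)) ^ p * cos (π / 8 - -u / 4 - θ) +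
      sin (4 * (π / 8 - u / 4)) ^ p * cos (π / 8 - u / 4 - θ)) =
      2 * cos (π / 8 - θ) * cosIntegral p (1 / 4) := by
    rw [cosIntegral, ← intervalIntegral.integral_const_mul]
    refine integral_congr fun u _ => ?_
    rw [show 4 * (π / 8 - -u / 4) = π / 2 - -u by ring, show 4 * (π / 8 - u / 4) = π / 2 - u by ring,
      sin_pi_div_two_sub, sin_pi_div_two_sub, cos_neg,
      show π / 8 - -u / 4 - θ = (π / 8 - θ) + 1 / 4 * u by ring,
      show π / 8 - u / 4 - θ = (π / 8 - θ) - 1 / 4 * u by ring, cos_add (π / 8 - θ),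
      cos_sub (π / 8 - θ) (1 / 4 * u)]
    ring
  rw [h4, cosIntegral_eq hp (by rw [abs_of_pos] <;> norm_num)] at h2
  have hdup := Gamma_mul_Gamma_add_half ((p + 1) / 2)
  rw [show 2 * ((p + 1) / 2) = p + 1 by ring, show (p + 1) / 2 + 1 / 2 = 1 + p / 2 by ring,
    show 1 - (p + 1) = -p by ring] at hdup
  rw [← h2, show 1 + (p + 1 / 4) / 2 = 9 / 8 + p / 2 by ring,
    show 1 + (p - 1 / 4) / 2 = 7 / 8 + p / 2 by ring] at h1
  have hG1 := (Gamma_pos_of_pos (show 0 < 9 / 8 + p / 2 by linarith)).ne'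
  have hG2 := (Gamma_pos_of_pos (show 0 < 7 / 8 + p / 2 by linarith)).ne'
  have hpow : (2 : ℝ) ^ (-p - 2) = 2 ^ (-p) / 4 := by
    rw [rpow_sub two_pos, rpow_two]; norm_num
  have hsq : √π * √π = π := mul_self_sqrt pi_pos.le
  rw [hpow]
  generalize Gamma (9 / 8 + p / 2) = G₁ at *
  generalize Gamma (7 / 8 + p / 2) = G₂ at *
  generalize Gamma ((p + 1) / 2) = G₃ at *
  generalize Gamma (1 + p / 2) = G₄ at *
  rw [eq_comm, ← mul_right_inj' (four_ne_zero (α := ℝ)), ← h1]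
  generalize Gamma (p + 1) = G₅ at *
  generalize (2 : ℝ) ^ (-p) = x at *
  generalize cos (π / 8 - θ) = y at *
  field_simp
  linear_combination (-(y * √π)) * hdup - (y * G₅ * x) * hsq

open Real MeasureTheory intervalIntegral in
-- This is sin 4φ = 4 sin φ cos φ cos 2φ.
theorem integral_trig_eq_sin_four_mul (p θ : ℝ) (f : ℝ → ℝ)
    (hf : ∀ φ ∈ Set.Ioo 0 (π / 4), f φ =
      2 * ((sin φ * cos (2 * φ) * cos φ) ^ p * cos (φ - θ))) :
    ∫ φ in (0 : ℝ)..(π / 4), f φ =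
      2 * 2 ^ (-(2 * p)) * ∫ φ in (0 : ℝ)..(π / 4), sin (4 * φ) ^ p * cos (φ - θ) := by
  rw [← intervalIntegral.integral_const_mul]
  refine integral_congr_Ioo_of_le (by positivity) fun φ hφ => ?_
  have hs : 0 < sin φ := sin_pos_of_pos_of_lt_pi hφ.1 (by linarith [hφ.2, pi_pos])
  have hc : 0 < cos φ := cos_pos_of_mem_Ioo ⟨by linarith [hφ.1, pi_pos], by linarith [hφ.2, pi_pos]⟩
  have hd : 0 < cos (2 * φ) := cos_pos_of_mem_Ioo
    ⟨by linarith [hφ.1, pi_pos], by linarith [hφ.2, pi_pos]⟩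
  have h4 : sin (4 * φ) = 2 ^ (2 : ℝ) * (sin φ * cos (2 * φ) * cos φ) := by
    rw [show 4 * φ = 2 * (2 * φ) by ring, sin_two_mul, sin_two_mul, rpow_two]; ring
  have hX : 0 < sin φ * cos (2 * φ) * cos φ := by positivity
  rw [hf φ hφ, h4]
  generalize sin φ * cos (2 * φ) * cos φ = X at hX
  rw [mul_rpow (by positivity) hX.le, ← rpow_mul two_pos.le, rpow_neg two_pos.le]
  field_simp

/-- A common real evaluation behind the series whose Euler integral is a cosine integral. -/
theorem regSum_eq_of_cos_integral {A b c p θ : ℝ} (hp : 0 < p) (hb : 0 < b) (hc : b < c)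
    (hs : -1 < c - A - b) (hcb : c - b - 1 = p)
    (htrig : ∀ φ : ℝ, 0 < Real.sin φ → 0 < Real.cos φ →
      Real.sin φ ^ (2 * b - 1) * Real.cos φ ^ (2 * A - 2 * c + 1) =
        (Real.sin φ * Real.cos φ) ^ p * Real.cos (φ - θ)) :
    regSum A b c = (Real.cos (Real.pi / 8 - θ) * Real.pi * 2 ^ (-(3 * p) - 1) /
      (Real.Gamma b * (Real.Gamma (9 / 8 + p / 2) * Real.Gamma (7 / 8 + p / 2))) : ℝ) := by
  have h := regSum_ofReal_eq_integral hb hc hs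
  rw [integral_euler_eq_integral_trig, integral_trig_eq_sin_four_mul p θ,
    integral_sin_four_mul_rpow hp, show c - b = p + 1 by linarith] at h
  · have hG0 := (Real.Gamma_pos_of_pos hb).ne'
    have hG1 := (Real.Gamma_pos_of_pos (show 0 < p + 1 by linarith)).ne'
    have hG2 := (Real.Gamma_pos_of_pos (show 0 < 9 / 8 + p / 2 by linarith)).ne'
    have hG3 := (Real.Gamma_pos_of_pos (show 0 < 7 / 8 + p / 2 by linarith)).ne'
    have hpow : (2 : ℝ) ^ (-(3 * p) - 1) = 2 * 2 ^ (-(2 * p)) * 2 ^ (-p - 2) := by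
      rw [mul_assoc, ← Real.rpow_add two_pos, ← Real.rpow_one_add' zero_le_two (by linarith)]
      congr 1; ring
    rw [← eq_div_iff (Complex.ofReal_ne_zero.2 (mul_ne_zero hG0 hG1)), ← Complex.ofReal_div] at h
    rw [h, Complex.ofReal_inj, hpow]
    generalize Real.Gamma (9 / 8 + p / 2) = G₁ at *
    generalize Real.Gamma (7 / 8 + p / 2) = G₂ at *
    field_simp
  · intro φ hφ
    have hsin : 0 < Real.sin φ :=
      Real.sin_pos_of_pos_of_lt_pi hφ.1 (by linarith [hφ.2, Real.pi_pos])
    have hcos : 0 < Real.cos φ := Real.cos_pos_of_mem_Ioo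
      ⟨by linarith [hφ.1, Real.pi_pos], by linarith [hφ.2, Real.pi_pos]⟩
    have hd : 0 < Real.cos (2 * φ) := Real.cos_pos_of_mem_Ioo
      ⟨by linarith [hφ.1, Real.pi_pos], by linarith [hφ.2, Real.pi_pos]⟩
    have h1 := htrig φ hsin hcos
    rw [Real.mul_rpow hsin.le hcos.le] at h1
    rw [Real.mul_rpow (by positivity) hcos.le, Real.mul_rpow hsin.le hd.le, hcb]
    linear_combination (2 * Real.cos (2 * φ) ^ p) * h1

/-- The exponent of sin φ exceeds the other two by 1, so θ = π/2. The interval (3, 4) is exactly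
where p > 0 and the excess is above -1. -/
theorem regSum_line_two {a : ℂ} (h : -1 < (1 - 1 / 2 * a).re) :
    regSum (a - 3 / 2) (1 / 4 * a + 1 / 4) (3 / 4 * a - 1 / 4) =
      Real.sin (Real.pi / 8) * Real.pi * 2 ^ (7 / 2 - 3 / 2 * a) *
        ((Complex.Gamma (1 / 4 * a + 1 / 4))⁻¹ * ((Complex.Gamma (3 / 8 + 1 / 4 * a))⁻¹ *
          (Complex.Gamma (1 / 8 + 1 / 4 * a))⁻¹)) := by
  refine regSum_eq_of_eq_on_interval (A := fun a => a - 3 / 2) (B := fun a => 1 / 4 * a + 1 / 4)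
    (C := fun a => 3 / 4 * a - 1 / 4) (R := fun a => Real.sin (Real.pi / 8) * Real.pi *
      2 ^ (7 / 2 - 3 / 2 * a) * ((Complex.Gamma (1 / 4 * a + 1 / 4))⁻¹ *
      ((Complex.Gamma (3 / 8 + 1 / 4 * a))⁻¹ * (Complex.Gamma (1 / 8 + 1 / 4 * a))⁻¹)))
    (e₀ := 1) (e₁ := -(1 / 2)) (l := 3) (u := 4) (by fun_prop) (by fun_prop) (by fun_prop) ?_
    (by norm_num) (fun z => by push_cast; ring) (fun x hx => by linarith [hx.2]) ?_ ?_
  · exact ((differentiable_two_cpow (by fun_prop)).const_mul _).mul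
      ((differentiable_inv_Gamma_comp (by fun_prop)).mul
        ((differentiable_inv_Gamma_comp (by fun_prop)).mul
          (differentiable_inv_Gamma_comp (by fun_prop))))
  · intro x hx
    have key := regSum_eq_of_cos_integral (A := x - 3 / 2) (b := 1 / 4 * x + 1 / 4)
      (c := 3 / 4 * x - 1 / 4) (p := 1 / 2 * x - 3 / 2) (θ := Real.pi / 2) (by linarith [hx.1])
      (by linarith [hx.1]) (by linarith [hx.1]) (by linarith [hx.2]) (by ring) ?_
    · rw [show Real.cos (Real.pi / 8 - Real.pi / 2) = Real.sin (Real.pi / 8) by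
        rw [← Real.cos_neg, neg_sub, Real.cos_pi_div_two_sub]] at key
      push_cast [-Complex.ofReal_sin] at key
      rw [key, Complex.ofReal_cpow two_pos.le, ← Complex.Gamma_ofReal, ← Complex.Gamma_ofReal,
        ← Complex.Gamma_ofReal]
      push_cast
      rw [div_eq_mul_inv, mul_inv, mul_inv]
      ring_nf
    · intro φ hs hc
      rw [Real.cos_sub_pi_div_two, Real.mul_rpow hs.le hc.le,
        show 2 * (1 / 4 * x + 1 / 4) - 1 = 1 / 2 * x - 3 / 2 + 1 by ring,
        Real.rpow_add_one hs.ne',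
        show 2 * (x - 3 / 2) - 2 * (3 / 4 * x - 1 / 4) + 1 = 1 / 2 * x - 3 / 2 by ring]
      ring
  · convert h using 2; ring

/-- Here the extra factor is cos φ, so θ = 0; positivity of p and convergence confine a to (2, 3).
-/
theorem regSum_line_three {a : ℂ} (h : -1 < (1 / 2 - 1 / 2 * a).re) :
    regSum (a - 1 / 2) (1 / 4 * a) (3 / 4 * a) =
      Real.cos (Real.pi / 8) * Real.pi * 2 ^ (2 - 3 / 2 * a) *
        ((Complex.Gamma (1 / 4 * a))⁻¹ * ((Complex.Gamma (5 / 8 + 1 / 4 * a))⁻¹ *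
          (Complex.Gamma (3 / 8 + 1 / 4 * a))⁻¹)) := by
  refine regSum_eq_of_eq_on_interval (A := fun a => a - 1 / 2) (B := fun a => 1 / 4 * a)
    (C := fun a => 3 / 4 * a) (R := fun a => Real.cos (Real.pi / 8) * Real.pi *
      2 ^ (2 - 3 / 2 * a) * ((Complex.Gamma (1 / 4 * a))⁻¹ *
      ((Complex.Gamma (5 / 8 + 1 / 4 * a))⁻¹ * (Complex.Gamma (3 / 8 + 1 / 4 * a))⁻¹)))
    (e₀ := 1 / 2) (e₁ := -(1 / 2)) (l := 2) (u := 3) (by fun_prop) (by fun_prop) (by fun_prop) ?_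
    (by norm_num) (fun z => by push_cast; ring) (fun x hx => by linarith [hx.2]) ?_ ?_
  · exact ((differentiable_two_cpow (by fun_prop)).const_mul _).mul
      ((differentiable_inv_Gamma_comp (by fun_prop)).mul
        ((differentiable_inv_Gamma_comp (by fun_prop)).mul
          (differentiable_inv_Gamma_comp (by fun_prop))))
  · intro x hx
    have key := regSum_eq_of_cos_integral (A := x - 1 / 2) (b := 1 / 4 * x)
      (c := 3 / 4 * x) (p := 1 / 2 * x - 1) (θ := 0) (by linarith [hx.1])
      (by linarith [hx.1]) (by linarith [hx.1]) (by linarith [hx.2]) (by ring) ?_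
    · push_cast at key
      rw [key, sub_zero, Complex.ofReal_cpow two_pos.le, ← Complex.Gamma_ofReal,
        ← Complex.Gamma_ofReal, ← Complex.Gamma_ofReal]
      push_cast
      rw [div_eq_mul_inv, mul_inv, mul_inv]
      ring_nf
    · intro φ hs hc
      rw [sub_zero, Real.mul_rpow hs.le hc.le,
        show 2 * (1 / 4 * x) - 1 = 1 / 2 * x - 1 by ring,
        show 2 * (x - 1 / 2) - 2 * (3 / 4 * x) + 1 = 1 / 2 * x - 1 + 1 by ring,
        Real.rpow_add_one hc.ne']
      ring
  · convert h using 2; ring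

/-- The factor 1/(a - 3) of the contiguity relation is absorbed by 1/Γ(a/2 - 3/2) = (a/2 -
3/2)/Γ(a/2 - 1/2), so the right side is entire. On (9/2, 5) both Kummer's theorem and the relation
apply. -/
theorem regSum_line_one {a : ℂ} (h : -1 < (6 - 4 / 3 * a).re) :
    regSum (a - 4) (2 / 3 * a - 1) (1 + 1 / 3 * a) =
      3 / 8 * √Real.pi * 2 ^ (4 - a) *
        ((Complex.Gamma (1 / 2 * a - 3 / 2 + 1))⁻¹ * (Complex.Gamma (2 - 1 / 6 * a))⁻¹) := by
  refine regSum_eq_of_eq_on_interval (A := fun a => a - 4) (B := fun a => 2 / 3 * a - 1)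
    (C := fun a => 1 + 1 / 3 * a) (R := fun a => 3 / 8 * √Real.pi * 2 ^ (4 - a) *
        ((Complex.Gamma (1 / 2 * a - 3 / 2 + 1))⁻¹ * (Complex.Gamma (2 - 1 / 6 * a))⁻¹))
    (e₀ := 6) (e₁ := -(4 / 3)) (l := 9 / 2) (u := 5) (by fun_prop) (by fun_prop) (by fun_prop) ?_
    (by norm_num) (fun z => by push_cast; ring) (fun x hx => by linarith [hx.2]) ?_ ?_
  · exact ((differentiable_two_cpow (by fun_prop)).const_mul _).mul
      ((differentiable_inv_Gamma_comp (by fun_prop)).mul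
        (differentiable_inv_Gamma_comp (by fun_prop)))
  · intro x hx
    have h0 : ∀ n : ℕ, 2 / 3 * (x : ℂ) - 3 + n ≠ 0 := fun n => by
      have : (0 : ℝ) ≤ n := n.cast_nonneg
      have h1 : 2 / 3 * x - 3 + n ≠ 0 := by linarith [hx.1]
      have h2 := Complex.ofReal_ne_zero.2 h1
      push_cast at h2
      exact h2
    have hc : ∀ n : ℕ, 1 + 1 / 3 * (x : ℂ) + n ≠ 0 := fun n => by
      have : (0 : ℝ) ≤ n := n.cast_nonneg
      have h1 : 1 + 1 / 3 * x + n ≠ 0 := by linarith [hx.1]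
      have h2 := Complex.ofReal_ne_zero.2 h1
      push_cast at h2
      exact h2
    have hs : -1 < (6 - 4 / 3 * (x : ℂ)).re := by
      have h1 : (6 - 4 / 3 * (x : ℂ)) = ((6 - 4 / 3 * x : ℝ) : ℂ) := by push_cast; rfl
      rw [h1, Complex.ofReal_re]
      linarith [hx.2]
    have key := regSum_kummer (A := x - 4) (b := 2 / 3 * x - 3) (by linarith [hx.1])
      (by linarith [hx.2]) (by linarith [hx.2])
    have hG := Complex.one_div_Gamma_eq_self_mul_one_div_Gamma_add_one (1 / 2 * (x : ℂ) - 3 / 2)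
    have hx3 : (x : ℂ) - 3 ≠ 0 := by
      have h1 : x - 3 ≠ 0 := by linarith [hx.1]
      exact_mod_cast h1
    rw [show 1 + (x - 4) - (2 / 3 * x - 3) = 1 / 3 * x by ring,
      show (x - 4 + 1) / 2 = 1 / 2 * x - 3 / 2 by ring,
      show 1 + (x - 4) / 2 - (2 / 3 * x - 3) = 2 - 1 / 6 * x by ring,
      show -(x - 4) = 4 - x by ring] at key
    push_cast at key
    rw [Complex.ofReal_cpow two_pos.le, ← Complex.Gamma_ofReal, ← Complex.Gamma_ofReal] at key
    push_cast at key
    rw [regSum_contiguous_sub_four hs h0 hc, key, div_eq_mul_inv _ (Complex.Gamma _ * _),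
      mul_inv (Complex.Gamma _), hG]
    field_simp
    ring
  · convert h using 2; ring

/-- Kummer's theorem needs 2a/3 + 1 > 0 and convergence needs a < -3/4. On the resulting interval
a/3 lies strictly between -1/2 and -1/4, so the lower parameter avoids the poles. -/
theorem regSum_line_four {a : ℂ} (h : -1 < (-2 - 4 / 3 * a).re) :
    regSum (a + 2) (2 / 3 * a) (1 / 3 * a) =
      -((2 * a + 3) * a / 9) * (√Real.pi * 2 ^ (-a - 2)) *
        ((Complex.Gamma (3 / 2 + 1 / 2 * a))⁻¹ * (Complex.Gamma (1 - 1 / 6 * a))⁻¹) := by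
  refine regSum_eq_of_eq_on_interval (A := fun a => a + 2) (B := fun a => 2 / 3 * a)
    (C := fun a => 1 / 3 * a) (R := fun a => -((2 * a + 3) * a / 9) * (√Real.pi * 2 ^ (-a - 2)) *
        ((Complex.Gamma (3 / 2 + 1 / 2 * a))⁻¹ * (Complex.Gamma (1 - 1 / 6 * a))⁻¹))
    (e₀ := -2) (e₁ := -(4 / 3)) (l := -(3 / 2)) (u := -(3 / 4)) (by fun_prop) (by fun_prop)
    (by fun_prop) ?_
    (by norm_num) (fun z => by push_cast; ring) (fun x hx => by linarith [hx.2]) ?_ ?_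
  · exact (Differentiable.mul (by fun_prop) ((differentiable_two_cpow (by fun_prop)).const_mul _)).mul
      ((differentiable_inv_Gamma_comp (by fun_prop)).mul
        (differentiable_inv_Gamma_comp (by fun_prop)))
  · intro x hx
    have h0 : ∀ n : ℕ, 1 / 3 * (x : ℂ) + n ≠ 0 := fun n => by
      have h1 : 1 / 3 * x + n ≠ 0 := by
        rcases n with _ | n
        · have := hx.2; push_cast; linarith
        · have : (0 : ℝ) ≤ n := n.cast_nonneg
          have := hx.1; push_cast; linarith
      have h2 := Complex.ofReal_ne_zero.2 h1
      push_cast at h2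
      exact h2
    have hs : -1 < (-2 - 4 / 3 * (x : ℂ)).re := by
      have h1 : (-2 - 4 / 3 * (x : ℂ)) = ((-2 - 4 / 3 * x : ℝ) : ℂ) := by push_cast; rfl
      rw [h1, Complex.ofReal_re]
      linarith [hx.2]
    have key := regSum_kummer (A := x + 2) (b := 2 / 3 * x + 1) (by linarith [hx.1])
      (by linarith [hx.2]) (by linarith [hx.2])
    rw [show 1 + (x + 2) - (2 / 3 * x + 1) = 1 / 3 * x + 2 by ring,
      show (x + 2 + 1) / 2 = 3 / 2 + 1 / 2 * x by ring,
      show 1 + (x + 2) / 2 - (2 / 3 * x + 1) = 1 - 1 / 6 * x by ring,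
      show -(x + 2) = -x - 2 by ring] at key
    push_cast at key
    rw [Complex.ofReal_cpow two_pos.le, ← Complex.Gamma_ofReal, ← Complex.Gamma_ofReal] at key
    push_cast at key
    rw [regSum_contiguous_add_two hs h0, key, div_eq_mul_inv _ (_ * _), mul_inv]
    ring
  · convert h using 2; ring

/-! ### Conversion to the stated gamma quotients. -/

theorem Gamma_one_half_eq_sqrt : Complex.Gamma (1 / 2) = (√Real.pi : ℂ) := by
  rw [← Real.Gamma_one_half_eq, ← Complex.Gamma_ofReal]
  push_cast
  rfl

theorem sqrt_pi_mul_self : (√Real.pi : ℂ) * √Real.pi = Real.pi := by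
  rw [← Complex.ofReal_mul, Real.mul_self_sqrt Real.pi_pos.le]

theorem sqrt_pi_ne_zero : (√Real.pi : ℂ) ≠ 0 :=
  Complex.ofReal_ne_zero.2 (Real.sqrt_pos.2 Real.pi_pos).ne'

theorem two_cpow_ne_zero (s : ℂ) : (2 : ℂ) ^ s ≠ 0 := by simp [Complex.cpow_eq_zero_iff]

theorem hasGammaEvaluation_line_one (a : ℂ) : HasGammaEvaluation (contiguousPoint 0 a)
    [1 / 2, 1 / 3 * a, 1 + 1 / 3 * a, 2 / 3 * a - 3 / 2, 2 / 3 * a - 2]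
    [1 / 2 * a - 3 / 2, 1 / 6 * a, 1 / 2 + 1 / 6 * a, 2 - 1 / 6 * a, 4 / 3 * a - 3] := by
  intro hs hc hup
  have key := twoFOneNegOneHasSum_of_regSum hs hc
  change -1 < (1 + 1 / 3 * a - (a - 4) - (2 / 3 * a - 1)).re at hs
  rw [show 1 + 1 / 3 * a - (a - 4) - (2 / 3 * a - 1) = 6 - 4 / 3 * a by ring] at hs
  convert key using 1
  change _ = Complex.Gamma (1 + 1 / 3 * a) *
    regSum (a - 4) (2 / 3 * a - 1) (1 + 1 / 3 * a)
  rw [regSum_line_one hs]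
  simp only [List.mem_cons, List.not_mem_nil, or_false, forall_eq_or_imp, forall_eq] at hup
  obtain ⟨-, h2, -, h4, h5⟩ := hup
  have g2 := Complex.Gamma_ne_zero h2
  have g4 := Complex.Gamma_ne_zero h4
  have g5 := Complex.Gamma_ne_zero h5
  have d1 := Complex.Gamma_mul_Gamma_add_half (1 / 6 * a)
  have d2 := Complex.Gamma_mul_Gamma_add_half (2 / 3 * a - 2)
  rw [show 1 / 6 * a + 1 / 2 = 1 / 2 + 1 / 6 * a by ring,
    show 2 * (1 / 6 * a) = 1 / 3 * a by ring] at d1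
  rw [show 2 / 3 * a - 2 + 1 / 2 = 2 / 3 * a - 3 / 2 by ring,
    show 2 * (2 / 3 * a - 2) = 4 / 3 * a - 4 by ring] at d2
  have h3 : a - 3 ≠ 0 := fun h => h5 0 (by push_cast; linear_combination 2 / 3 * h)
  have r1 := Complex.Gamma_add_one (4 / 3 * a - 4)
    (fun h => h3 (by linear_combination 3 / 4 * h))
  rw [show 4 / 3 * a - 4 + 1 = 4 / 3 * a - 3 by ring] at r1
  have r2 := Complex.one_div_Gamma_eq_self_mul_one_div_Gamma_add_one (1 / 2 * a - 3 / 2)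
  have hp : (2 : ℂ) ^ (1 - (4 / 3 * a - 4)) = 2 ^ (1 - 1 / 3 * a) * 2 ^ (4 - a) := by
    rw [← Complex.cpow_add _ _ two_ne_zero]; congr 1; ring
  have p1 := two_cpow_ne_zero (1 - 1 / 3 * a)
  have p2 := sqrt_pi_ne_zero
  -- At its poles `Complex.Gamma` takes the value 0, so the duplication formula with two nonzero
  -- factors on the left excludes a pole here.
  have g6 : Complex.Gamma (4 / 3 * a - 4) ≠ 0 := fun h => by
    rw [h, zero_mul, zero_mul] at d2
    exact mul_ne_zero g5 g4 d2
  simp only [gammaQuotient, List.map_cons, List.map_nil, List.prod_cons, List.prod_nil, mul_one]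
  rw [Gamma_one_half_eq_sqrt, r1]
  rw [hp] at d2
  calc _ = √Real.pi * Complex.Gamma (1 / 3 * a) * Complex.Gamma (1 + 1 / 3 * a) *
        (Complex.Gamma (2 / 3 * a - 2) * Complex.Gamma (2 / 3 * a - 3 / 2)) *
        (Complex.Gamma (1 / 2 * a - 3 / 2))⁻¹ * (Complex.Gamma (2 - 1 / 6 * a))⁻¹ *
        (Complex.Gamma (1 / 6 * a) * Complex.Gamma (1 / 2 + 1 / 6 * a))⁻¹ *
        ((4 / 3 * a - 4) * Complex.Gamma (4 / 3 * a - 4))⁻¹ := by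
        simp only [div_eq_mul_inv, mul_inv]; ring
    _ = _ := by
        rw [d1, d2, r2]
        generalize Complex.Gamma (4 / 3 * a - 4) = G at *
        generalize Complex.Gamma (1 / 3 * a) = H at *
        generalize (Complex.Gamma (1 / 2 * a - 3 / 2 + 1))⁻¹ = X
        generalize (Complex.Gamma (2 - 1 / 6 * a))⁻¹ = Y
        generalize (2 : ℂ) ^ (1 - 1 / 3 * a) = x at *
        rw [show 4 / 3 * a - 4 = 4 / 3 * (a - 3) by ring]
        field_simp
        ring

theorem hasGammaEvaluation_line_four (a : ℂ) : HasGammaEvaluation (contiguousPoint 3 a)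
    [1 / 2, 1 / 3 * a, 1 + 1 / 3 * a, 3 / 2 + 2 / 3 * a, 2 + 2 / 3 * a]
    [3 / 2 + 1 / 2 * a, 1 / 2 + 1 / 6 * a, 1 + 1 / 6 * a, -(1 / 6 * a), 2 + 4 / 3 * a] := by
  intro hs hc hup
  have key := twoFOneNegOneHasSum_of_regSum hs hc
  change -1 < (1 / 3 * a - (a + 2) - (2 / 3 * a)).re at hs
  rw [show 1 / 3 * a - (a + 2) - (2 / 3 * a) = -2 - 4 / 3 * a by ring] at hs
  convert key using 1
  change _ = Complex.Gamma (1 / 3 * a) * regSum (a + 2) (2 / 3 * a) (1 / 3 * a)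
  rw [regSum_line_four hs]
  simp only [List.mem_cons, List.not_mem_nil, or_false, forall_eq_or_imp, forall_eq] at hup
  obtain ⟨-, h2, h3, h4, h5⟩ := hup
  have g3 := Complex.Gamma_ne_zero h3
  have g4 := Complex.Gamma_ne_zero h4
  have g5 := Complex.Gamma_ne_zero h5
  have d1 := Complex.Gamma_mul_Gamma_add_half (1 / 2 + 1 / 6 * a)
  have d2 := Complex.Gamma_mul_Gamma_add_half (3 / 2 + 2 / 3 * a)
  rw [show 1 / 2 + 1 / 6 * a + 1 / 2 = 1 + 1 / 6 * a by ring,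
    show 2 * (1 / 2 + 1 / 6 * a) = 1 + 1 / 3 * a by ring] at d1
  rw [show 3 / 2 + 2 / 3 * a + 1 / 2 = 2 + 2 / 3 * a by ring,
    show 2 * (3 / 2 + 2 / 3 * a) = 2 + 4 / 3 * a + 1 by ring] at d2
  have r1 := Complex.one_div_Gamma_eq_self_mul_one_div_Gamma_add_one (2 + 4 / 3 * a)
  have r2 := Complex.one_div_Gamma_eq_self_mul_one_div_Gamma_add_one (-(1 / 6 * a))
  rw [show -(1 / 6 * a) + 1 = 1 - 1 / 6 * a by ring] at r2
  have hp : (2 : ℂ) ^ (1 - (2 + 4 / 3 * a + 1)) = 2 ^ (1 - (1 + 1 / 3 * a)) * 2 ^ (-a - 2) := by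
    rw [← Complex.cpow_add _ _ two_ne_zero]; congr 1; ring
  have p1 := two_cpow_ne_zero (1 - (1 + 1 / 3 * a))
  have p2 := sqrt_pi_ne_zero
  have g6 : Complex.Gamma (2 + 4 / 3 * a + 1) ≠ 0 := fun h => by
    rw [h, zero_mul, zero_mul] at d2
    exact mul_ne_zero g4 g5 d2
  simp only [gammaQuotient, List.map_cons, List.map_nil, List.prod_cons, List.prod_nil, mul_one]
  rw [Gamma_one_half_eq_sqrt]
  rw [hp] at d2
  calc _ = √Real.pi * Complex.Gamma (1 / 3 * a) * Complex.Gamma (1 + 1 / 3 * a) *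
        (Complex.Gamma (3 / 2 + 2 / 3 * a) * Complex.Gamma (2 + 2 / 3 * a)) *
        (Complex.Gamma (3 / 2 + 1 / 2 * a))⁻¹ * (Complex.Gamma (-(1 / 6 * a)))⁻¹ *
        (Complex.Gamma (1 / 2 + 1 / 6 * a) * Complex.Gamma (1 + 1 / 6 * a))⁻¹ *
        (Complex.Gamma (2 + 4 / 3 * a))⁻¹ := by
        simp only [div_eq_mul_inv, mul_inv]; ring
    _ = _ := by
        rw [d1, d2, r1, r2]
        generalize Complex.Gamma (2 + 4 / 3 * a + 1) = G at *
        generalize Complex.Gamma (1 + 1 / 3 * a) = H at *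
        generalize (Complex.Gamma (3 / 2 + 1 / 2 * a))⁻¹ = X
        generalize (Complex.Gamma (1 - 1 / 6 * a))⁻¹ = Y
        generalize (2 : ℂ) ^ (1 - (1 + 1 / 3 * a)) = x at *
        field_simp
        ring

theorem hasGammaEvaluation_line_two (a : ℂ) : HasGammaEvaluation (contiguousPoint 1 a)
    [1 / 2, 3 / 2, 3 / 4 + 1 / 4 * a, 1 / 2 * a, 3 / 4 * a - 1 / 4]
    [7 / 8, 9 / 8, a, 1 / 8 + 1 / 4 * a, 3 / 8 + 1 / 4 * a] := by
  intro hs hc hup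
  have key := twoFOneNegOneHasSum_of_regSum hs hc
  change -1 < (3 / 4 * a - 1 / 4 - (a - 3 / 2) - (1 / 4 * a + 1 / 4)).re at hs
  rw [show 3 / 4 * a - 1 / 4 - (a - 3 / 2) - (1 / 4 * a + 1 / 4) = 1 - 1 / 2 * a by ring] at hs
  convert key using 1
  change _ = Complex.Gamma (3 / 4 * a - 1 / 4) *
    regSum (a - 3 / 2) (1 / 4 * a + 1 / 4) (3 / 4 * a - 1 / 4)
  rw [regSum_line_two hs]
  simp only [List.mem_cons, List.not_mem_nil, or_false, forall_eq_or_imp, forall_eq] at hup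
  obtain ⟨-, -, h3, h4, -⟩ := hup
  have g3 := Complex.Gamma_ne_zero h3
  have g4 := Complex.Gamma_ne_zero h4
  have d1 := Complex.Gamma_mul_Gamma_add_half (1 / 2 * a)
  have d2 := Complex.Gamma_mul_Gamma_add_half (1 / 4 * a + 1 / 4)
  rw [show 2 * (1 / 2 * a) = a by ring] at d1
  rw [show 1 / 4 * a + 1 / 4 + 1 / 2 = 3 / 4 + 1 / 4 * a by ring,
    show 2 * (1 / 4 * a + 1 / 4) = 1 / 2 * a + 1 / 2 by ring] at d2
  have p2 := sqrt_pi_ne_zero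
  have hp : (2 : ℂ) ^ (7 / 2 - 3 / 2 * a) = 4 * (2 ^ (1 - a) * 2 ^ (1 - (1 / 2 * a + 1 / 2))) := by
    rw [← Complex.cpow_add _ _ two_ne_zero, show (4 : ℂ) = 2 ^ (2 : ℂ) by norm_num,
      ← Complex.cpow_add _ _ two_ne_zero]
    congr 1; ring
  have e1 : Complex.Gamma (3 / 2) = √Real.pi / 2 := by
    rw [show (3 / 2 : ℂ) = 1 / 2 + 1 by norm_num, Complex.Gamma_add_one _ (by norm_num),
      Gamma_one_half_eq_sqrt]
    ring
  have hsin : (Real.sin (Real.pi / 8) : ℂ) ≠ 0 := Complex.ofReal_ne_zero.2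
    (Real.sin_pos_of_pos_of_lt_pi (by positivity) (by linarith [Real.pi_pos])).ne'
  have hpi : (Real.pi : ℂ) ≠ 0 := Complex.ofReal_ne_zero.2 Real.pi_ne_zero
  -- The reflection formula at 1/8; it accounts for the constant sin(π/8) coming from the cosine
  -- integral.
  have e2 : Complex.Gamma (7 / 8) * Complex.Gamma (9 / 8) =
      Real.pi / (8 * Real.sin (Real.pi / 8)) := by
    have h := Complex.Gamma_mul_Gamma_one_sub (1 / 8)
    rw [show (1 - 1 / 8 : ℂ) = 7 / 8 by norm_num] at h
    rw [show (9 / 8 : ℂ) = 1 / 8 + 1 by norm_num, Complex.Gamma_add_one _ (by norm_num),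
      mul_left_comm, mul_comm (Complex.Gamma (7 / 8)), h, Complex.ofReal_sin]
    push_cast
    rw [mul_one_div]
    ring
  have hmain : Complex.Gamma (3 / 4 + 1 / 4 * a) * Complex.Gamma (1 / 2 * a) *
      (Complex.Gamma a)⁻¹ = 2 ^ (1 - a) * 2 ^ (1 - (1 / 2 * a + 1 / 2)) * Real.pi *
        (Complex.Gamma (1 / 4 * a + 1 / 4))⁻¹ := by
    -- If a is a pole, which the hypotheses allow, two duplications show that a/4 + 1/4 is a pole as
    -- well, and both sides vanish.
    by_cases h0 : Complex.Gamma a = 0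
    · rw [h0, zero_mul, zero_mul] at d1
      rw [(mul_eq_zero.1 d1).resolve_left g4, zero_mul, zero_mul] at d2
      rw [h0, (mul_eq_zero.1 d2).resolve_right g3]
      simp
    · have g5 : Complex.Gamma (1 / 2 * a + 1 / 2) ≠ 0 := fun h => by
        rw [h, mul_zero, eq_comm] at d1
        exact mul_ne_zero (mul_ne_zero h0 (two_cpow_ne_zero _)) p2 d1
      have g6 : Complex.Gamma (1 / 4 * a + 1 / 4) ≠ 0 := fun h => by
        rw [h, zero_mul, eq_comm] at d2
        exact mul_ne_zero (mul_ne_zero g5 (two_cpow_ne_zero _)) p2 d2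
      rw [← div_eq_mul_inv, ← div_eq_mul_inv, div_eq_div_iff h0 g6, ← sqrt_pi_mul_self]
      refine mul_right_cancel₀ g5 ?_
      linear_combination (Complex.Gamma (1 / 2 * a) * Complex.Gamma (1 / 2 * a + 1 / 2)) * d2 +
        (Complex.Gamma (1 / 2 * a + 1 / 2) * 2 ^ (1 - (1 / 2 * a + 1 / 2)) * √Real.pi) * d1
  simp only [gammaQuotient, List.map_cons, List.map_nil, List.prod_cons, List.prod_nil, mul_one]
  rw [Gamma_one_half_eq_sqrt, e1, hp]
  calc _ = (√Real.pi * √Real.pi) / 2 * (Complex.Gamma (3 / 4 + 1 / 4 * a) *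
        Complex.Gamma (1 / 2 * a) * (Complex.Gamma a)⁻¹) * Complex.Gamma (3 / 4 * a - 1 / 4) *
        (Complex.Gamma (7 / 8) * Complex.Gamma (9 / 8))⁻¹ *
        ((Complex.Gamma (3 / 8 + 1 / 4 * a))⁻¹ * (Complex.Gamma (1 / 8 + 1 / 4 * a))⁻¹) := by
        simp only [div_eq_mul_inv, mul_inv]; ring
    _ = _ := by
        rw [hmain, e2, sqrt_pi_mul_self]
        generalize (Complex.Gamma (1 / 4 * a + 1 / 4))⁻¹ = X
        generalize (Complex.Gamma (3 / 8 + 1 / 4 * a))⁻¹ = Y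
        generalize (Complex.Gamma (1 / 8 + 1 / 4 * a))⁻¹ = Z
        generalize (Real.sin (Real.pi / 8) : ℂ) = s at *
        field_simp
        ring

theorem hasGammaEvaluation_line_three (a : ℂ) : HasGammaEvaluation (contiguousPoint 2 a)
    [1 / 2, 1 / 2, 1 / 2 + 1 / 4 * a, 1 / 2 + 1 / 2 * a, 3 / 4 * a]
    [3 / 8, 5 / 8, a, 3 / 8 + 1 / 4 * a, 5 / 8 + 1 / 4 * a] := by
  intro hs hc hup
  have key := twoFOneNegOneHasSum_of_regSum hs hc
  change -1 < (3 / 4 * a - (a - 1 / 2) - (1 / 4 * a)).re at hs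
  rw [show 3 / 4 * a - (a - 1 / 2) - (1 / 4 * a) = 1 / 2 - 1 / 2 * a by ring] at hs
  convert key using 1
  change _ = Complex.Gamma (3 / 4 * a) * regSum (a - 1 / 2) (1 / 4 * a) (3 / 4 * a)
  rw [regSum_line_three hs]
  simp only [List.mem_cons, List.not_mem_nil, or_false, forall_eq_or_imp, forall_eq] at hup
  obtain ⟨-, -, h3, h4, -⟩ := hup
  have g3 := Complex.Gamma_ne_zero h3
  have g4 := Complex.Gamma_ne_zero h4
  have d1 := Complex.Gamma_mul_Gamma_add_half (1 / 2 * a)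
  have d2 := Complex.Gamma_mul_Gamma_add_half (1 / 4 * a)
  rw [show 2 * (1 / 2 * a) = a by ring, add_comm (1 / 2 * a)] at d1
  rw [add_comm (1 / 4 * a), show 2 * (1 / 4 * a) = 1 / 2 * a by ring] at d2
  have p2 := sqrt_pi_ne_zero
  have hp : (2 : ℂ) ^ (2 - 3 / 2 * a) = 2 ^ (1 - a) * 2 ^ (1 - 1 / 2 * a) := by
    rw [← Complex.cpow_add _ _ two_ne_zero]
    congr 1; ring
  have hcos : (Real.cos (Real.pi / 8) : ℂ) ≠ 0 := Complex.ofReal_ne_zero.2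
    (Real.cos_pos_of_mem_Ioo ⟨by linarith [Real.pi_pos], by linarith [Real.pi_pos]⟩).ne'
  have hpi : (Real.pi : ℂ) ≠ 0 := Complex.ofReal_ne_zero.2 Real.pi_ne_zero
  have e2 : Complex.Gamma (3 / 8) * Complex.Gamma (5 / 8) = Real.pi / Real.cos (Real.pi / 8) := by
    have h := Complex.Gamma_mul_Gamma_one_sub (3 / 8)
    rw [show (1 - 3 / 8 : ℂ) = 5 / 8 by norm_num] at h
    rw [h, ← Real.sin_pi_div_two_sub, Complex.ofReal_sin]
    congr 2
    push_cast
    ring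
  have hmain : Complex.Gamma (1 / 2 + 1 / 4 * a) * Complex.Gamma (1 / 2 + 1 / 2 * a) *
      (Complex.Gamma a)⁻¹ = 2 ^ (1 - a) * 2 ^ (1 - 1 / 2 * a) * Real.pi *
        (Complex.Gamma (1 / 4 * a))⁻¹ := by
    by_cases h0 : Complex.Gamma a = 0
    · rw [h0, zero_mul, zero_mul] at d1
      rw [(mul_eq_zero.1 d1).resolve_right g4, zero_mul, zero_mul] at d2
      rw [h0, (mul_eq_zero.1 d2).resolve_right g3]
      simp
    · have g5 : Complex.Gamma (1 / 2 * a) ≠ 0 := fun h => by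
        rw [h, zero_mul, eq_comm] at d1
        exact mul_ne_zero (mul_ne_zero h0 (two_cpow_ne_zero _)) p2 d1
      have g6 : Complex.Gamma (1 / 4 * a) ≠ 0 := fun h => by
        rw [h, zero_mul, eq_comm] at d2
        exact mul_ne_zero (mul_ne_zero g5 (two_cpow_ne_zero _)) p2 d2
      rw [← div_eq_mul_inv, ← div_eq_mul_inv, div_eq_div_iff h0 g6, ← sqrt_pi_mul_self]
      linear_combination Complex.Gamma (1 / 2 + 1 / 2 * a) * d2 +
        (2 ^ (1 - 1 / 2 * a) * √Real.pi) * d1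
  simp only [gammaQuotient, List.map_cons, List.map_nil, List.prod_cons, List.prod_nil, mul_one]
  rw [Gamma_one_half_eq_sqrt, hp]
  calc _ = (√Real.pi * √Real.pi) * (Complex.Gamma (1 / 2 + 1 / 4 * a) *
        Complex.Gamma (1 / 2 + 1 / 2 * a) * (Complex.Gamma a)⁻¹) * Complex.Gamma (3 / 4 * a) *
        (Complex.Gamma (3 / 8) * Complex.Gamma (5 / 8))⁻¹ *
        ((Complex.Gamma (5 / 8 + 1 / 4 * a))⁻¹ * (Complex.Gamma (3 / 8 + 1 / 4 * a))⁻¹) := by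
        simp only [div_eq_mul_inv, mul_inv]; ring
    _ = _ := by
        rw [hmain, e2, sqrt_pi_mul_self]
        generalize (Complex.Gamma (1 / 4 * a))⁻¹ = X
        generalize (Complex.Gamma (5 / 8 + 1 / 4 * a))⁻¹ = Y
        generalize (Complex.Gamma (3 / 8 + 1 / 4 * a))⁻¹ = Z
        generalize (Real.cos (Real.pi / 8) : ℂ) = s at *
        field_simp

/-! ### The intersections as pairings of coordinates. -/

/-- Three times the coordinates `(x, y, z; u, v)` of the point of `whippleBasePlane` over a point of
the `₂F₁` parameter space. -/
noncomputable def whippleCoord (q : Fin 3 → ℂ) : Fin 5 → ℂ :=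
  ![q 2 - q 1 - q 0 / 2 - 1 / 2, q 2 - q 1 - q 0 / 2 + 1, q 2 + 2 * q 1 - 2 * q 0 - 1 / 2,
    q 0 + q 1 / 2 - q 2 / 2 - 1 / 2, q 0 + q 1 / 2 - q 2 / 2 + 1]

/-- The projection of the intersection of `whippleBasePlane` with the plane on which both the
coordinates with indices `i`, `j` and those with indices `k`, `l` have sum `1 / 3`. -/
def pairPlane (i j k l : Fin 5) : Set (Fin 3 → ℂ) :=
  {q | whippleCoord q i + whippleCoord q j = 1 ∧ whippleCoord q k + whippleCoord q l = 1}

/-- The point of `whippleBasePlane` over a point of the `₂F₁` parameter space. -/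
noncomputable def whippleSection (q : Fin 3 → ℂ) : Fin 5 → ℂ :=
  ![q 0 / 2, q 0 / 2 + 1 / 2, q 1, (q 1 + q 2) / 2, (q 1 + q 2) / 2 + 1 / 2]

theorem whippleMap_whippleSection (q : Fin 3 → ℂ) : whippleMap (whippleSection q) = q := by
  funext i
  fin_cases i <;> simp [whippleMap, whippleSection] <;> ring

theorem whippleSection_whippleMap {p : Fin 5 → ℂ} (hp : p ∈ whippleBasePlane) :
    whippleSection (whippleMap p) = p := by
  obtain ⟨h1, h4⟩ := hp
  funext i
  fin_cases i <;> simp [whippleMap, whippleSection, h1, h4]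

theorem whippleSection_mem (q : Fin 3 → ℂ) : whippleSection q ∈ whippleBasePlane := by
  simp [whippleBasePlane, whippleSection]

theorem thomaeCoord_symm_whippleSection (q : Fin 3 → ℂ) (i : Fin 5) :
    thomaeCoord.symm (whippleSection q) i = whippleCoord q i / 3 := by
  rw [thomaeCoord_symm_apply]
  fin_cases i <;> simp [whippleCoord, whippleSection] <;> ring

/-- Dixon's equations read 2(y + u) + (z + v) = 1 and (y + u) + 2(z + v) = 1, that is y + u = z + v
= 1/3. A permutation only changes which coordinates are paired. -/
theorem thomaeHom_mem_dixonPlane_iff (σ : Equiv.Perm (Fin 5)) (q : Fin 3 → ℂ) :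
    thomaeHom σ (whippleSection q) ∈ dixonPlane ↔
      q ∈ pairPlane (σ⁻¹ 1) (σ⁻¹ 3) (σ⁻¹ 2) (σ⁻¹ 4) := by
  have hs : thomaeHom σ (whippleSection q) =
      thomaeCoord (fun i => thomaeCoord.symm (whippleSection q) (σ⁻¹ i)) := rfl
  rw [hs, thomaeCoord_apply]
  simp only [thomaeCoord_symm_whippleSection, dixonPlane, pairPlane, Set.mem_ofPred_eq,
    Matrix.cons_val]
  generalize whippleCoord q (σ⁻¹ 0) = x
  generalize whippleCoord q (σ⁻¹ 1) = y
  generalize whippleCoord q (σ⁻¹ 2) = z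
  generalize whippleCoord q (σ⁻¹ 3) = u
  generalize whippleCoord q (σ⁻¹ 4) = v
  constructor
  · rintro ⟨h₁, h₂⟩
    constructor
    · linear_combination 2 * h₁ - h₂
    · linear_combination 2 * h₂ - h₁
  · rintro ⟨h₁, h₂⟩
    constructor
    · linear_combination (2 / 3) * h₁ + (1 / 3) * h₂
    · linear_combination (1 / 3) * h₁ + (2 / 3) * h₂

/-- Pulling back by T = `thomaeHom τ` replaces W by W₀ and D by T⁻¹D, so only `ρ⁻¹ * τ` matters; on
W₀ the projection is a bijection with inverse `whippleSection`. -/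
theorem image_inter_eq_pairPlane (ρ τ σ : Equiv.Perm (Fin 5)) (h : σ = ρ⁻¹ * τ) :
    (fun p => whippleMap ((thomaeHom τ)⁻¹ p)) ''
        (thomaeHom ρ '' dixonPlane ∩ thomaeHom τ '' whippleBasePlane) =
      pairPlane (σ⁻¹ 1) (σ⁻¹ 3) (σ⁻¹ 2) (σ⁻¹ 4) := by
  have hσ : ∀ p, thomaeHom σ p = (thomaeHom ρ)⁻¹ (thomaeHom τ p) := fun p => by
    rw [h, map_mul, map_inv]; rfl
  have hinv : ∀ p, (thomaeHom τ)⁻¹ (thomaeHom τ p) = p := (thomaeHom τ).symm_apply_apply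
  have hinvρ : ∀ p, (thomaeHom ρ)⁻¹ (thomaeHom ρ p) = p := (thomaeHom ρ).symm_apply_apply
  have hinvρ' : ∀ p, thomaeHom ρ ((thomaeHom ρ)⁻¹ p) = p := (thomaeHom ρ).apply_symm_apply
  ext q
  rw [← thomaeHom_mem_dixonPlane_iff, hσ]
  constructor
  · rintro ⟨p, ⟨⟨d, hd, hdp⟩, ⟨w, hw, rfl⟩⟩, rfl⟩
    simp only [hinv]
    rw [whippleSection_whippleMap hw, ← hdp, hinvρ]
    exact hd
  · intro hq
    refine ⟨thomaeHom τ (whippleSection q), ⟨⟨_, hq, hinvρ' _⟩, _, whippleSection_mem q, rfl⟩, ?_⟩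
    simp only [hinv, whippleMap_whippleSection]

theorem exists_perm_of_mem_projectedIntersections {F : Set (Fin 3 → ℂ)}
    (hF : F ∈ projectedIntersections) :
    ∃ σ : Equiv.Perm (Fin 5), F = pairPlane (σ 1) (σ 3) (σ 2) (σ 4) := by
  obtain ⟨D, ⟨_, ⟨ρ, rfl⟩, rfl⟩, W, -, _, ⟨τ, rfl⟩, rfl, -, rfl⟩ := hF
  exact ⟨(ρ⁻¹ * τ)⁻¹, image_inter_eq_pairPlane ρ τ _ rfl⟩

theorem pairPlane_mem_projectedIntersections (σ : Equiv.Perm (Fin 5))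
    (h : (pairPlane (σ 1) (σ 3) (σ 2) (σ 4)).Nonempty) :
    pairPlane (σ 1) (σ 3) (σ 2) (σ 4) ∈ projectedIntersections := by
  have himg := image_inter_eq_pairPlane σ 1 σ⁻¹ (by simp)
  rw [inv_inv] at himg
  refine ⟨_, ⟨thomaeHom σ, ⟨σ, rfl⟩, rfl⟩, _, ⟨thomaeHom 1, ⟨1, rfl⟩, rfl⟩, thomaeHom 1, ⟨1, rfl⟩,
    rfl, ?_, himg.symm⟩
  rw [← himg] at h
  exact h.of_image

/-! ### Equivalence under the interchange and Euler's transformation. -/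

theorem eulerEquivalent_of_forall {V V' : Set (Fin 3 → ℂ)} {g : Equiv.Perm (Fin 3 → ℂ)}
    (hg : g ∈ Subgroup.closure {upperSwap, eulerTransformation}) (h : ∀ q, g q ∈ V' ↔ q ∈ V) :
    EulerEquivalent V V' := by
  refine ⟨g, hg, ?_⟩
  ext q
  rw [Equiv.image_eq_preimage_symm, Set.mem_preimage, ← h, Equiv.apply_symm_apply]

theorem eulerEquivalent_of_eq {V V' : Set (Fin 3 → ℂ)} (h : ∀ q : Fin 3 → ℂ, q ∈ V' ↔ q ∈ V) :
    EulerEquivalent V V' :=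
  eulerEquivalent_of_forall (one_mem _) h

theorem upperSwap_mem : upperSwap ∈ Subgroup.closure {upperSwap, eulerTransformation} :=
  Subgroup.subset_closure (by simp)

theorem eulerTransformation_mem :
    eulerTransformation ∈ Subgroup.closure {upperSwap, eulerTransformation} :=
  Subgroup.subset_closure (by simp)

theorem eulerEquivalent_of_swap {V V' : Set (Fin 3 → ℂ)}
    (h : ∀ q : Fin 3 → ℂ, ![q 1, q 0, q 2] ∈ V' ↔ q ∈ V) : EulerEquivalent V V' :=
  eulerEquivalent_of_forall upperSwap_mem h

theorem eulerEquivalent_of_euler {V V' : Set (Fin 3 → ℂ)}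
    (h : ∀ q : Fin 3 → ℂ, ![q 2 - q 0, q 2 - q 1, q 2] ∈ V' ↔ q ∈ V) : EulerEquivalent V V' :=
  eulerEquivalent_of_forall eulerTransformation_mem h

theorem eulerEquivalent_of_euler_swap {V V' : Set (Fin 3 → ℂ)}
    (h : ∀ q : Fin 3 → ℂ, ![q 2 - q 1, q 2 - q 0, q 2] ∈ V' ↔ q ∈ V) : EulerEquivalent V V' :=
  eulerEquivalent_of_forall (mul_mem eulerTransformation_mem upperSwap_mem) h

/-- The group generated by the interchange and Euler's transformation has four elements. -/
theorem apply_of_mem_closure {g : Equiv.Perm (Fin 3 → ℂ)}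
    (hg : g ∈ Subgroup.closure {upperSwap, eulerTransformation}) :
    (∀ q, g q = q) ∨ (∀ q, g q = ![q 1, q 0, q 2]) ∨
      (∀ q, g q = ![q 2 - q 0, q 2 - q 1, q 2]) ∨ ∀ q, g q = ![q 2 - q 1, q 2 - q 0, q 2] := by
  induction hg using Subgroup.closure_induction with
  | mem x hx =>
    rcases hx with rfl | rfl
    · exact Or.inr (Or.inl fun q => rfl)
    · exact Or.inr (Or.inr (Or.inl fun q => rfl))
  | one => exact Or.inl fun q => rfl
  | mul x y _ _ hx hy =>
    have e : ∀ q : Fin 3 → ℂ, ![q 0, q 1, q 2] = q := fun q => by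
      funext i; fin_cases i <;> rfl
    rcases hx with hx | hx | hx | hx <;> rcases hy with hy | hy | hy | hy <;>
      simp [hx, hy, e]
  | inv x _ hx =>
    have e : ∀ q : Fin 3 → ℂ, ![q 0, q 1, q 2] = q := fun q => by
      funext i; fin_cases i <;> rfl
    rcases hx with hx | hx | hx | hx
    · refine Or.inl fun q => ?_
      rw [Equiv.Perm.inv_eq_iff_eq, hx]
    · refine Or.inr (Or.inl fun q => ?_)
      rw [Equiv.Perm.inv_eq_iff_eq, hx]; simp [e]
    · refine Or.inr (Or.inr (Or.inl fun q => ?_))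
      rw [Equiv.Perm.inv_eq_iff_eq, hx]; simp [e]
    · refine Or.inr (Or.inr (Or.inr fun q => ?_))
      rw [Equiv.Perm.inv_eq_iff_eq, hx]; simp [e]

theorem mem_contiguousLine_iff {ν m₁ k₁ m₂ k₂ : ℂ} {i : Fin 4}
    (h : ∀ a, contiguousPoint i a = ![a + ν, m₁ * a + k₁, m₂ * a + k₂]) (q : Fin 3 → ℂ) :
    q ∈ contiguousLine i ↔ q 1 = m₁ * (q 0 - ν) + k₁ ∧ q 2 = m₂ * (q 0 - ν) + k₂ := by
  constructor
  · rintro ⟨a, rfl⟩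
    rw [h]
    simp
  · rintro ⟨h1, h2⟩
    refine ⟨q 0 - ν, ?_⟩
    rw [h]
    funext j
    fin_cases j <;> simp [h1, h2]

theorem mem_contiguousLine_zero (q : Fin 3 → ℂ) : q ∈ contiguousLine 0 ↔
    q 1 = 2 / 3 * (q 0 - -4) + -1 ∧ q 2 = 1 / 3 * (q 0 - -4) + 1 :=
  mem_contiguousLine_iff (fun a => by simp [contiguousPoint]; ring_nf; simp) q

theorem mem_contiguousLine_one (q : Fin 3 → ℂ) : q ∈ contiguousLine 1 ↔
    q 1 = 1 / 4 * (q 0 - -(3 / 2)) + 1 / 4 ∧ q 2 = 3 / 4 * (q 0 - -(3 / 2)) + -(1 / 4) :=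
  mem_contiguousLine_iff (fun a => by simp [contiguousPoint]; ring_nf; simp) q

theorem mem_contiguousLine_two (q : Fin 3 → ℂ) : q ∈ contiguousLine 2 ↔
    q 1 = 1 / 4 * (q 0 - -(1 / 2)) + 0 ∧ q 2 = 3 / 4 * (q 0 - -(1 / 2)) + 0 :=
  mem_contiguousLine_iff (fun a => by simp [contiguousPoint]; ring) q

theorem mem_contiguousLine_three (q : Fin 3 → ℂ) : q ∈ contiguousLine 3 ↔
    q 1 = 2 / 3 * (q 0 - 2) + 0 ∧ q 2 = 1 / 3 * (q 0 - 2) + 0 :=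
  mem_contiguousLine_iff (fun a => by simp [contiguousPoint]) q

/-- The alternative in the classification of the projected intersections. -/
def KummerOrContiguous (F : Set (Fin 3 → ℂ)) : Prop :=
  (∃ G, EulerEquivalent F G ∧ G ⊆ kummerPlane) ∨ ∃ i : Fin 4, EulerEquivalent F (contiguousLine i)

theorem kummerOrContiguous_of_swap {F : Set (Fin 3 → ℂ)}
    (h : ∀ q ∈ F, q 2 = 1 + q 1 - q 0) : KummerOrContiguous F := by
  refine Or.inl ⟨_, ⟨upperSwap, upperSwap_mem, rfl⟩, ?_⟩
  rintro _ ⟨q, hq, rfl⟩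
  exact h q hq

/-! ### Classification of the fifteen pairings. -/

theorem pairPlane_symm_left (i j k l : Fin 5) : pairPlane i j k l = pairPlane j i k l := by
  simp only [pairPlane, add_comm (whippleCoord _ i)]

theorem pairPlane_symm_right (i j k l : Fin 5) : pairPlane i j k l = pairPlane i j l k := by
  simp only [pairPlane, add_comm (whippleCoord _ k)]

theorem pairPlane_swap (i j k l : Fin 5) : pairPlane i j k l = pairPlane k l i j := by
  simp only [pairPlane, and_comm]

/-- Euler's transformation composed with the interchange exchanges the coordinate indices 0 ↔ 3 and
1 ↔ 4 and fixes 2. This is why each of the four lines arises from two pairings. -/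
theorem eulerEquivalent_pairPlane_zero_one_two_three :
    EulerEquivalent (pairPlane 0 1 2 3) (contiguousLine 1) := by
  refine eulerEquivalent_of_eq fun q => ?_
  simp only [mem_contiguousLine_one, pairPlane, whippleCoord, Set.mem_ofPred_eq, Matrix.cons_val]
  constructor <;> rintro ⟨h₁, h₂⟩ <;> constructor <;> grind

theorem eulerEquivalent_pairPlane_zero_one_two_four :
    EulerEquivalent (pairPlane 0 1 2 4) (contiguousLine 2) := by
  refine eulerEquivalent_of_eq fun q => ?_
  simp only [mem_contiguousLine_two, pairPlane, whippleCoord, Set.mem_ofPred_eq, Matrix.cons_val]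
  constructor <;> rintro ⟨h₁, h₂⟩ <;> constructor <;> grind

theorem eulerEquivalent_pairPlane_zero_two_one_four :
    EulerEquivalent (pairPlane 0 2 1 4) (contiguousLine 3) := by
  refine eulerEquivalent_of_swap fun q => ?_
  simp only [mem_contiguousLine_three, pairPlane, whippleCoord, Set.mem_ofPred_eq, Matrix.cons_val]
  constructor <;> rintro ⟨h₁, h₂⟩ <;> constructor <;> grind

theorem eulerEquivalent_pairPlane_zero_two_three_four :
    EulerEquivalent (pairPlane 0 2 3 4) (contiguousLine 1) := by
  refine eulerEquivalent_of_euler_swap fun q => ?_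
  simp only [mem_contiguousLine_one, pairPlane, whippleCoord, Set.mem_ofPred_eq, Matrix.cons_val]
  constructor <;> rintro ⟨h₁, h₂⟩ <;> constructor <;> grind

theorem eulerEquivalent_pairPlane_zero_three_one_two :
    EulerEquivalent (pairPlane 0 3 1 2) (contiguousLine 0) := by
  refine eulerEquivalent_of_swap fun q => ?_
  simp only [mem_contiguousLine_zero, pairPlane, whippleCoord, Set.mem_ofPred_eq, Matrix.cons_val]
  constructor <;> rintro ⟨h₁, h₂⟩ <;> constructor <;> grind

theorem eulerEquivalent_pairPlane_zero_three_two_four :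
    EulerEquivalent (pairPlane 0 3 2 4) (contiguousLine 0) := by
  refine eulerEquivalent_of_euler fun q => ?_
  simp only [mem_contiguousLine_zero, pairPlane, whippleCoord, Set.mem_ofPred_eq, Matrix.cons_val]
  constructor <;> rintro ⟨h₁, h₂⟩ <;> constructor <;> grind

theorem eulerEquivalent_pairPlane_one_two_three_four :
    EulerEquivalent (pairPlane 1 2 3 4) (contiguousLine 2) := by
  refine eulerEquivalent_of_euler_swap fun q => ?_
  simp only [mem_contiguousLine_two, pairPlane, whippleCoord, Set.mem_ofPred_eq, Matrix.cons_val]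
  constructor <;> rintro ⟨h₁, h₂⟩ <;> constructor <;> grind

theorem eulerEquivalent_pairPlane_one_four_two_three :
    EulerEquivalent (pairPlane 1 4 2 3) (contiguousLine 3) := by
  refine eulerEquivalent_of_euler fun q => ?_
  simp only [mem_contiguousLine_three, pairPlane, whippleCoord, Set.mem_ofPred_eq, Matrix.cons_val]
  constructor <;> rintro ⟨h₁, h₂⟩ <;> constructor <;> grind

/-- On W₀ the coordinates 0 and 1 differ by the same amount as 3 and 4, so the two equations
coincide and a full plane remains. -/
theorem eulerEquivalent_pairPlane_zero_four_one_three :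
    EulerEquivalent (pairPlane 0 4 1 3) kummerPlane := by
  refine eulerEquivalent_of_swap fun q => ?_
  simp only [kummerPlane, pairPlane, whippleCoord, Set.mem_ofPred_eq, Matrix.cons_val]
  constructor
  · intro h
    constructor <;> grind
  · rintro ⟨h₁, h₂⟩
    grind

/-- The seven matchings whose planes lie in the Kummer plane. -/
theorem kummerOrContiguous_of_kummer {i j k l : Fin 5}
    (h : (i, j, k, l) ∈ [((0 : Fin 5), (1 : Fin 5), (3 : Fin 5), (4 : Fin 5)), (0, 2, 1, 3),
      (0, 3, 1, 4), (0, 4, 1, 2), (0, 4, 1, 3), (0, 4, 2, 3), (1, 3, 2, 4)]) :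
    KummerOrContiguous (pairPlane i j k l) := by
  -- Pairing 0 with 4, or 1 with 3, is the interchanged Kummer condition itself. For 01|34 that
  -- condition follows from the two equations; for 03|14 they contradict each other and the set is
  -- empty.
  refine kummerOrContiguous_of_swap ?_
  simp only [List.mem_cons, List.not_mem_nil, or_false, Prod.mk.injEq] at h
  rcases h with ⟨rfl, rfl, rfl, rfl⟩ | ⟨rfl, rfl, rfl, rfl⟩ | ⟨rfl, rfl, rfl, rfl⟩ |
    ⟨rfl, rfl, rfl, rfl⟩ | ⟨rfl, rfl, rfl, rfl⟩ | ⟨rfl, rfl, rfl, rfl⟩ | ⟨rfl, rfl, rfl, rfl⟩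
  all_goals
    rintro q ⟨h₁, h₂⟩
    simp only [whippleCoord, Matrix.cons_val] at h₁ h₂
    grind

theorem kummerOrContiguous_of_lt {i j k l : Fin 5} (hij : i < j) (hkl : k < l) (hik : i < k)
    (hjk : j ≠ k) (hjl : j ≠ l) : KummerOrContiguous (pairPlane i j k l) := by
  have hcases : (i, j, k, l) ∈ [((0 : Fin 5), (1 : Fin 5), (3 : Fin 5), (4 : Fin 5)), (0, 2, 1, 3),
      (0, 3, 1, 4), (0, 4, 1, 2), (0, 4, 1, 3), (0, 4, 2, 3), (1, 3, 2, 4)] ∨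
      (i, j, k, l) ∈ [((0 : Fin 5), (1 : Fin 5), (2 : Fin 5), (3 : Fin 5)), (0, 1, 2, 4),
      (0, 2, 1, 4), (0, 2, 3, 4), (0, 3, 1, 2), (0, 3, 2, 4), (1, 2, 3, 4), (1, 4, 2, 3)] := by
    revert i j k l
    decide
  rcases hcases with h | h
  · exact kummerOrContiguous_of_kummer h
  simp only [List.mem_cons, List.not_mem_nil, or_false, Prod.mk.injEq] at h
  rcases h with ⟨rfl, rfl, rfl, rfl⟩ | ⟨rfl, rfl, rfl, rfl⟩ | ⟨rfl, rfl, rfl, rfl⟩ |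
    ⟨rfl, rfl, rfl, rfl⟩ | ⟨rfl, rfl, rfl, rfl⟩ | ⟨rfl, rfl, rfl, rfl⟩ | ⟨rfl, rfl, rfl, rfl⟩ |
    ⟨rfl, rfl, rfl, rfl⟩
  · exact Or.inr ⟨_, eulerEquivalent_pairPlane_zero_one_two_three⟩
  · exact Or.inr ⟨_, eulerEquivalent_pairPlane_zero_one_two_four⟩
  · exact Or.inr ⟨_, eulerEquivalent_pairPlane_zero_two_one_four⟩
  · exact Or.inr ⟨_, eulerEquivalent_pairPlane_zero_two_three_four⟩
  · exact Or.inr ⟨_, eulerEquivalent_pairPlane_zero_three_one_two⟩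
  · exact Or.inr ⟨_, eulerEquivalent_pairPlane_zero_three_two_four⟩
  · exact Or.inr ⟨_, eulerEquivalent_pairPlane_one_two_three_four⟩
  · exact Or.inr ⟨_, eulerEquivalent_pairPlane_one_four_two_three⟩

theorem kummerOrContiguous_pairPlane {i j k l : Fin 5} (hij : i ≠ j) (hkl : k ≠ l) (hik : i ≠ k)
    (hil : i ≠ l) (hjk : j ≠ k) (hjl : j ≠ l) : KummerOrContiguous (pairPlane i j k l) := by
  wlog h1 : i < j generalizing i j
  · rw [pairPlane_symm_left]
    exact this hij.symm hjk hjl hik hil (lt_of_le_of_ne (not_lt.1 h1) hij.symm)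
  wlog h2 : k < l generalizing k l
  · rw [pairPlane_symm_right]
    exact this hkl.symm hil hik hjl hjk (lt_of_le_of_ne (not_lt.1 h2) hkl.symm)
  rcases lt_or_gt_of_ne hik with h3 | h3
  · exact kummerOrContiguous_of_lt h1 h2 h3 hjk hjl
  · rw [pairPlane_swap]
    exact kummerOrContiguous_of_lt h2 h1 h3 hil.symm hjl.symm

theorem kummerOrContiguous_of_mem_projectedIntersections {F : Set (Fin 3 → ℂ)}
    (hF : F ∈ projectedIntersections) : KummerOrContiguous F := by
  obtain ⟨σ, rfl⟩ := exists_perm_of_mem_projectedIntersections hF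
  apply kummerOrContiguous_pairPlane <;> exact fun h => absurd (σ.injective h) (by decide)

/-! ### All classes occur and are distinct. -/

theorem pairPlane_mem_of_eulerEquivalent (σ : Equiv.Perm (Fin 5)) {V : Set (Fin 3 → ℂ)}
    (hV : V.Nonempty) (h : EulerEquivalent (pairPlane (σ 1) (σ 3) (σ 2) (σ 4)) V) :
    ∃ F ∈ projectedIntersections, EulerEquivalent F V := by
  refine ⟨_, pairPlane_mem_projectedIntersections σ ?_, h⟩
  obtain ⟨g, -, rfl⟩ := h
  exact hV.of_image

theorem exists_eulerEquivalent_kummerPlane :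
    ∃ F ∈ projectedIntersections, EulerEquivalent F kummerPlane := by
  let σ : Equiv.Perm (Fin 5) := ⟨![2, 0, 1, 4, 3], ![1, 2, 0, 4, 3], by decide, by decide⟩
  exact pairPlane_mem_of_eulerEquivalent σ ⟨![0, 0, 1], by simp [kummerPlane]⟩
    eulerEquivalent_pairPlane_zero_four_one_three

theorem exists_eulerEquivalent_contiguousLine (i : Fin 4) :
    ∃ F ∈ projectedIntersections, EulerEquivalent F (contiguousLine i) := by
  have hne : (contiguousLine i).Nonempty := Set.range_nonempty _
  fin_cases i
  · let σ : Equiv.Perm (Fin 5) := ⟨![4, 0, 1, 3, 2], ![1, 2, 4, 3, 0], by decide, by decide⟩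
    exact pairPlane_mem_of_eulerEquivalent σ hne eulerEquivalent_pairPlane_zero_three_one_two
  · let σ : Equiv.Perm (Fin 5) := ⟨![4, 0, 2, 1, 3], ![1, 3, 2, 4, 0], by decide, by decide⟩
    exact pairPlane_mem_of_eulerEquivalent σ hne eulerEquivalent_pairPlane_zero_one_two_three
  · let σ : Equiv.Perm (Fin 5) := ⟨![3, 0, 2, 1, 4], ![1, 3, 2, 0, 4], by decide, by decide⟩
    exact pairPlane_mem_of_eulerEquivalent σ hne eulerEquivalent_pairPlane_zero_one_two_four
  · let σ : Equiv.Perm (Fin 5) := ⟨![3, 0, 1, 2, 4], ![1, 2, 3, 0, 4], by decide, by decide⟩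
    exact pairPlane_mem_of_eulerEquivalent σ hne eulerEquivalent_pairPlane_zero_two_one_four

/-- The point with a = 0 already leaves the Kummer plane under each of the four group elements. -/
theorem not_subset_kummerPlane {i : Fin 4} {G : Set (Fin 3 → ℂ)}
    (h : EulerEquivalent (contiguousLine i) G) : ¬ G ⊆ kummerPlane := by
  obtain ⟨g, hg, rfl⟩ := h
  intro hsub
  have hp := hsub ⟨contiguousPoint i 0, ⟨0, rfl⟩, rfl⟩
  rcases apply_of_mem_closure hg with h | h | h | h <;> rw [h] at hp <;> fin_cases i <;>
    simp [kummerPlane, contiguousPoint] at hp <;> norm_num at hp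

/-- For i ≠ j, each of the four group elements moves at least one of the points with a = 0 and a = 4
off the other line. -/
theorem eq_of_eulerEquivalent_contiguousLine {i j : Fin 4}
    (h : EulerEquivalent (contiguousLine i) (contiguousLine j)) : i = j := by
  obtain ⟨g, hg, hij⟩ := h
  have h0 : g (contiguousPoint i 0) ∈ contiguousLine j := hij ▸ ⟨_, ⟨0, rfl⟩, rfl⟩
  have h1 : g (contiguousPoint i 4) ∈ contiguousLine j := hij ▸ ⟨_, ⟨4, rfl⟩, rfl⟩
  clear hij
  rcases apply_of_mem_closure hg with h | h | h | h <;> rw [h] at h0 h1 <;> clear h <;>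
    fin_cases j <;> fin_cases i <;> first | rfl | exfalso <;>
    simp [contiguousPoint, mem_contiguousLine_zero, mem_contiguousLine_one, mem_contiguousLine_two,
      mem_contiguousLine_three] at h0 h1 <;>
    first | (norm_num at h0; done) | norm_num at h1

theorem mainTheorem8 :
    -- every projected intersection lies in the Kummer plane or is one of the four lines
    (∀ F ∈ projectedIntersections,
      (∃ G, EulerEquivalent F G ∧ G ⊆ kummerPlane) ∨
        ∃ i : Fin 4, EulerEquivalent F (contiguousLine i)) ∧
    -- the Kummer plane and all four lines occur
    (∃ F ∈ projectedIntersections, EulerEquivalent F kummerPlane) ∧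
    (∀ i : Fin 4, ∃ F ∈ projectedIntersections, EulerEquivalent F (contiguousLine i)) ∧
    -- no line lies in the Kummer plane, and the four lines are distinct
    (∀ (i : Fin 4) (G : Set (Fin 3 → ℂ)),
      EulerEquivalent (contiguousLine i) G → ¬ G ⊆ kummerPlane) ∧
    (∀ i j : Fin 4, EulerEquivalent (contiguousLine i) (contiguousLine j) → i = j) ∧
    -- the four evaluations
    (∀ a : ℂ, HasGammaEvaluation (contiguousPoint 0 a)
      [1 / 2, 1 / 3 * a, 1 + 1 / 3 * a, 2 / 3 * a - 3 / 2, 2 / 3 * a - 2]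
      [1 / 2 * a - 3 / 2, 1 / 6 * a, 1 / 2 + 1 / 6 * a, 2 - 1 / 6 * a, 4 / 3 * a - 3]) ∧
    (∀ a : ℂ, HasGammaEvaluation (contiguousPoint 1 a)
      [1 / 2, 3 / 2, 3 / 4 + 1 / 4 * a, 1 / 2 * a, 3 / 4 * a - 1 / 4]
      [7 / 8, 9 / 8, a, 1 / 8 + 1 / 4 * a, 3 / 8 + 1 / 4 * a]) ∧
    (∀ a : ℂ, HasGammaEvaluation (contiguousPoint 2 a)
      [1 / 2, 1 / 2, 1 / 2 + 1 / 4 * a, 1 / 2 + 1 / 2 * a, 3 / 4 * a]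
      [3 / 8, 5 / 8, a, 3 / 8 + 1 / 4 * a, 5 / 8 + 1 / 4 * a]) ∧
    (∀ a : ℂ, HasGammaEvaluation (contiguousPoint 3 a)
      [1 / 2, 1 / 3 * a, 1 + 1 / 3 * a, 3 / 2 + 2 / 3 * a, 2 + 2 / 3 * a]
      [3 / 2 + 1 / 2 * a, 1 / 2 + 1 / 6 * a, 1 + 1 / 6 * a, -(1 / 6 * a), 2 + 4 / 3 * a]) :=   ⟨fun _ hF => kummerOrContiguous_of_mem_projectedIntersections hF,
    exists_eulerEquivalent_kummerPlane, exists_eulerEquivalent_contiguousLine,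
    fun _ _ h => not_subset_kummerPlane h, fun _ _ h => eq_of_eulerEquivalent_contiguousLine h,
    hasGammaEvaluation_line_one, hasGammaEvaluation_line_two, hasGammaEvaluation_line_three,
    hasGammaEvaluation_line_four⟩
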